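/- Let $G_1, G_2$ be infinite locally compact groups, each with a (regular) left Haar measure, and for $i=1,2$ let $\omega_i : G_i \to [1,\infty)$ be a weight function, i.e. a continuous function with $\omega_i(xy)\le\omega_i(x)\,\omega_i(y)$ for all $x,y\in G_i$ and $\omega_i(e)=1$. Let $L^1(G_i,\omega_i)$ be the Banach algebra of (classes of) complex Borel measurable functions $f$ on $G_i$ with $\|f\|_{\omega_i}=\int_{G_i}|f(x)|\,\omega_i(x)\,dx<\infty$, with the convolution product $(f*g)(x)=\int_{G_i} f(y)\,g(y^{-1}x)\,dy$. Let $L^1(G_1,\omega_1)\hat\otimes L^1(G_2,\omega_2)$ be the projective tensor product, i.e. the completion of the algebraic tensor product in the norm $\|u\|=\inf\{\sum_k\|a_k\|\,\|b_k\| : u=\sum_k a_k\otimes b_k\}$ (finite sums), with the product determined by $(a\otimes b)(a'\otimes b')=aa'\otimes bb'$. A Banach algebra $A$ is called weakly amenable if every bounded linear map $D:A\to A^*$ with $D(ab)=D(a)\cdot b+a\cdot D(b)$ for all $a,b \in A$ is inner, i.e. there is $z\in A^*$ such that $D(a)=z\cdot a-a\cdot z$ for all $a\in A$; here $\langle z\cdot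 a,x\rangle=\langle z,ax\rangle$ and $\langle a\cdot z,x\rangle=\langle z,xa\rangle$. If $L^1(G_1,\omega_1)\hat\otimes L^1(G_2,\omega_2)$ is weakly amenable, then both $L^1(G_1,\omega_1)$ and $L^1(G_2,\omega_2)$ are weakly amenable. -/

import Mathlib

section WeakAmenability

variable {A : Type*} [NonUnitalNormedRing A] [NormedSpace ℂ A] [IsScalarTower ℂ A A]
  [SMulCommClass ℂ A A]

/-- The left module action of a Banach algebra on its dual: `(a · z)(x) = z (x * a)`. -/
noncomputable def dualLeftAction (a : A) (z : StrongDual ℂ A) : StrongDual ℂ A :=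
  z.comp ((ContinuousLinearMap.mul ℂ A).flip a)

/-- The right module action of a Banach algebra on its dual: `(z · a)(x) = z (a * x)`. -/
noncomputable def dualRightAction (z : StrongDual ℂ A) (a : A) : StrongDual ℂ A :=
  z.comp (ContinuousLinearMap.mul ℂ A a)

/-- Bounded derivations from a Banach algebra into its dual. -/
def IsDualDerivation (D : A →L[ℂ] StrongDual ℂ A) : Prop :=
  ∀ a b : A, D (a * b) = dualRightAction (D a) b + dualLeftAction a (D b)

/-- Inner derivations `a ↦ z · a - a · z`. -/
def IsInnerDualDerivation (D : A →L[ℂ] StrongDual ℂ A) : Prop :=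
  ∃ z : StrongDual ℂ A, ∀ a : A, D a = dualRightAction z a - dualLeftAction a z

variable (A) in
/-- A Banach algebra is weakly amenable if the bounded derivations into its dual are exactly the
inner derivations. -/
def IsWeaklyAmenable [CompleteSpace A] : Prop :=
  {D : A →L[ℂ] StrongDual ℂ A | IsDualDerivation D} =
    {D : A →L[ℂ] StrongDual ℂ A | IsInnerDualDerivation D}

end WeakAmenability

section ProjectiveTensorProduct

open TensorProduct

/-- The projective norm on the algebraic tensor product: the infimum of `∑ ‖aᵢ‖ * ‖bᵢ‖` over all
representations `u = ∑ aᵢ ⊗ bᵢ`. -/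
noncomputable def projectiveTensorNorm {A B : Type*} [NonUnitalNormedRing A] [NormedSpace ℂ A]
    [NonUnitalNormedRing B] [NormedSpace ℂ B] (u : A ⊗[ℂ] B) : ℝ :=
  sInf {r : ℝ | ∃ (n : ℕ) (a : Fin n → A) (b : Fin n → B),
    u = ∑ i, a i ⊗ₜ[ℂ] b i ∧ r = ∑ i, ‖a i‖ * ‖b i‖}

namespace projectiveTensorNorm

variable {A B : Type*} [NonUnitalNormedRing A] [NormedSpace ℂ A]
    [NonUnitalNormedRing B] [NormedSpace ℂ B]

theorem le_of_eq_sum {u : A ⊗[ℂ] B} {n : ℕ} {a : Fin n → A} {b : Fin n → B}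
    (h : u = ∑ i, a i ⊗ₜ[ℂ] b i) : projectiveTensorNorm u ≤ ∑ i, ‖a i‖ * ‖b i‖ :=
  csInf_le ⟨0, by rintro r ⟨n, a, b, -, rfl⟩; positivity⟩ ⟨n, a, b, h, rfl⟩

theorem exists_lt (u : A ⊗[ℂ] B) {ε : ℝ} (hε : 0 < ε) :
    ∃ (n : ℕ) (a : Fin n → A) (b : Fin n → B),
      u = ∑ i, a i ⊗ₜ[ℂ] b i ∧ ∑ i, ‖a i‖ * ‖b i‖ < projectiveTensorNorm u + ε := by
  have hne : {r : ℝ | ∃ (n : ℕ) (a : Fin n → A) (b : Fin n → B),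
      u = ∑ i, a i ⊗ₜ[ℂ] b i ∧ r = ∑ i, ‖a i‖ * ‖b i‖}.Nonempty := by
    obtain ⟨n, s, h⟩ := TensorProduct.exists_finset u
    refine ⟨_, n.card, fun i => (n.equivFin.symm i).1.1, fun i => (n.equivFin.symm i).1.2, ?_, rfl⟩
    rw [← Finset.sum_coe_sort]
    exact (n.equivFin.symm.sum_comp (fun i => i.1.1 ⊗ₜ[ℂ] i.1.2)).symm
  obtain ⟨r, ⟨n, a, b, h, rfl⟩, hr⟩ := exists_lt_of_csInf_lt hne (lt_add_of_pos_right _ hε)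
  exact ⟨n, a, b, h, hr⟩

theorem nonneg (u : A ⊗[ℂ] B) : 0 ≤ projectiveTensorNorm u :=
  Real.sInf_nonneg (by rintro r ⟨n, a, b, -, rfl⟩; positivity)

theorem zero : projectiveTensorNorm (0 : A ⊗[ℂ] B) = 0 :=
  le_antisymm (by simpa using le_of_eq_sum (A := A) (B := B) (n := 0) (a := 0) (b := 0) (by simp))
    (nonneg _)

theorem tmul_le (a : A) (b : B) : projectiveTensorNorm (a ⊗ₜ[ℂ] b) ≤ ‖a‖ * ‖b‖ := by
  simpa using le_of_eq_sum (n := 1) (a := fun _ => a) (b := fun _ => b) (by simp)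

theorem add_le (u v : A ⊗[ℂ] B) :
    projectiveTensorNorm (u + v) ≤ projectiveTensorNorm u + projectiveTensorNorm v := by
  refine le_of_forall_pos_le_add fun ε hε => ?_
  obtain ⟨n, a, b, rfl, h⟩ := exists_lt u (half_pos hε)
  obtain ⟨m, a', b', rfl, h'⟩ := exists_lt v (half_pos hε)
  refine (le_of_eq_sum (n := n + m) (a := Fin.append a a') (b := Fin.append b b')
    (by simp [Fin.sum_univ_add])).trans ?_
  simp only [Fin.sum_univ_add, Fin.append_left, Fin.append_right]
  linarith

theorem smul_le (c : ℂ) (u : A ⊗[ℂ] B) :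
    projectiveTensorNorm (c • u) ≤ ‖c‖ * projectiveTensorNorm u := by
  refine le_of_forall_pos_le_add fun ε hε => ?_
  obtain ⟨n, a, b, hu, h⟩ := exists_lt u (ε := ε / (‖c‖ + 1)) (by positivity)
  refine (le_of_eq_sum (a := c • a) (b := b)
    (by rw [hu, Finset.smul_sum]; simp [TensorProduct.smul_tmul'])).trans ?_
  simp only [Pi.smul_apply, norm_smul, mul_assoc, ← Finset.mul_sum]
  have h1 : ‖c‖ * (ε / (‖c‖ + 1)) ≤ ε := by
    rw [← mul_div_assoc, div_le_iff₀ (by positivity)]; nlinarith [norm_nonneg c]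
  nlinarith [norm_nonneg c]

theorem neg (u : A ⊗[ℂ] B) : projectiveTensorNorm (-u) = projectiveTensorNorm u := by
  have key : ∀ v : A ⊗[ℂ] B, projectiveTensorNorm (-v) ≤ projectiveTensorNorm v := fun v => by
    simpa using smul_le (-1) v
  exact le_antisymm (key u) (by simpa using key (-u))

theorem sum_le {ι : Type*} (s : Finset ι) (u : ι → A ⊗[ℂ] B) :
    projectiveTensorNorm (∑ i ∈ s, u i) ≤ ∑ i ∈ s, projectiveTensorNorm (u i) :=
  Finset.le_sum_of_subadditive _ zero.le add_le _ _

variable [IsScalarTower ℂ A A] [SMulCommClass ℂ A A] [IsScalarTower ℂ B B] [SMulCommClass ℂ B B]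

theorem mul_le (u v : A ⊗[ℂ] B) :
    projectiveTensorNorm (u * v) ≤ projectiveTensorNorm u * projectiveTensorNorm v := by
  have key : ∀ ε : ℝ, 0 < ε → projectiveTensorNorm (u * v) ≤
      (projectiveTensorNorm u + ε) * (projectiveTensorNorm v + ε) := fun ε hε => by
    obtain ⟨n, a, b, hu, h⟩ := exists_lt u hε
    obtain ⟨m, a', b', hv, h'⟩ := exists_lt v hε
    have e : u * v = ∑ i, ∑ j, (a i * a' j) ⊗ₜ[ℂ] (b i * b' j) := by
      rw [hu, hv, Finset.sum_mul_sum]; simp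
    calc projectiveTensorNorm (u * v)
        ≤ ∑ i, ∑ j, ‖a i * a' j‖ * ‖b i * b' j‖ := by
          rw [e]
          exact (sum_le _ _).trans (Finset.sum_le_sum fun i _ => (sum_le _ _).trans
            (Finset.sum_le_sum fun j _ => tmul_le _ _))
      _ ≤ ∑ i, ∑ j, (‖a i‖ * ‖b i‖) * (‖a' j‖ * ‖b' j‖) := by
          refine Finset.sum_le_sum fun i _ => Finset.sum_le_sum fun j _ => ?_
          rw [mul_mul_mul_comm]
          gcongr <;> exact norm_mul_le _ _
      _ = (∑ i, ‖a i‖ * ‖b i‖) * (∑ j, ‖a' j‖ * ‖b' j‖) := by rw [Finset.sum_mul_sum]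
      _ ≤ _ := by
        have := nonneg u
        gcongr
  refine ge_of_tendsto (x := nhdsWithin (0 : ℝ) (Set.Ioi 0))
    (f := fun ε => (projectiveTensorNorm u + ε) * (projectiveTensorNorm v + ε)) ?_
    (Filter.eventually_of_mem self_mem_nhdsWithin key)
  have : Continuous fun ε : ℝ => (projectiveTensorNorm u + ε) * (projectiveTensorNorm v + ε) := by
    fun_prop
  simpa using (this.tendsto 0).mono_left nhdsWithin_le_nhds

end projectiveTensorNorm

/-- The algebraic tensor product, carrying the projective norm. -/
def AlgebraicProjectiveTensor (A B : Type*) [NonUnitalNormedRing A] [NormedSpace ℂ A]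
    [NonUnitalNormedRing B] [NormedSpace ℂ B] : Type _ := A ⊗[ℂ] B

namespace AlgebraicProjectiveTensor

variable (A B : Type*) [NonUnitalNormedRing A] [NormedSpace ℂ A]
  [NonUnitalNormedRing B] [NormedSpace ℂ B]

noncomputable instance : AddCommGroup (AlgebraicProjectiveTensor A B) :=
  inferInstanceAs (AddCommGroup (A ⊗[ℂ] B))

noncomputable instance : Module ℂ (AlgebraicProjectiveTensor A B) :=
  inferInstanceAs (Module ℂ (A ⊗[ℂ] B))

noncomputable instance : SeminormedAddCommGroup (AlgebraicProjectiveTensor A B) :=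
  AddGroupSeminorm.toSeminormedAddCommGroup
    { toFun := fun u => projectiveTensorNorm (A := A) (B := B) u
      map_zero' := projectiveTensorNorm.zero
      add_le' := projectiveTensorNorm.add_le
      neg' := projectiveTensorNorm.neg }

noncomputable instance : NormedSpace ℂ (AlgebraicProjectiveTensor A B) where
  norm_smul_le := projectiveTensorNorm.smul_le (A := A) (B := B)

variable [IsScalarTower ℂ A A] [SMulCommClass ℂ A A] [IsScalarTower ℂ B B] [SMulCommClass ℂ B B]

noncomputable instance : NonUnitalRing (AlgebraicProjectiveTensor A B) :=
  inferInstanceAs (NonUnitalRing (A ⊗[ℂ] B))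

noncomputable instance : NonUnitalSeminormedRing (AlgebraicProjectiveTensor A B) where
  __ := (inferInstance : SeminormedAddCommGroup (AlgebraicProjectiveTensor A B))
  __ := (inferInstance : NonUnitalRing (AlgebraicProjectiveTensor A B))
  norm_mul_le := projectiveTensorNorm.mul_le (A := A) (B := B)

instance : IsScalarTower ℂ (AlgebraicProjectiveTensor A B) (AlgebraicProjectiveTensor A B) :=
  inferInstanceAs (IsScalarTower ℂ (A ⊗[ℂ] B) (A ⊗[ℂ] B))

instance : SMulCommClass ℂ (AlgebraicProjectiveTensor A B) (AlgebraicProjectiveTensor A B) :=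
  inferInstanceAs (SMulCommClass ℂ (A ⊗[ℂ] B) (A ⊗[ℂ] B))

end AlgebraicProjectiveTensor

/-- The projective tensor product of two Banach algebras: the completion of the algebraic tensor
product in the projective norm. -/
def ProjectiveTensorProduct (A B : Type*) [NonUnitalNormedRing A] [NormedSpace ℂ A]
    [NonUnitalNormedRing B] [NormedSpace ℂ B] : Type _ :=
  UniformSpace.Completion (AlgebraicProjectiveTensor A B)

namespace ProjectiveTensorProduct

open UniformSpace

variable (A B : Type*) [NonUnitalNormedRing A] [NormedSpace ℂ A]
  [NonUnitalNormedRing B] [NormedSpace ℂ B]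

noncomputable instance : NormedAddCommGroup (ProjectiveTensorProduct A B) :=
  inferInstanceAs (NormedAddCommGroup (Completion (AlgebraicProjectiveTensor A B)))

noncomputable instance : NormedSpace ℂ (ProjectiveTensorProduct A B) :=
  inferInstanceAs (NormedSpace ℂ (Completion (AlgebraicProjectiveTensor A B)))

instance : CompleteSpace (ProjectiveTensorProduct A B) :=
  inferInstanceAs (CompleteSpace (Completion (AlgebraicProjectiveTensor A B)))

variable {A B}

/-- The canonical map of the algebraic tensor product into its completion. -/
noncomputable def ofAlgebraic (u : AlgebraicProjectiveTensor A B) : ProjectiveTensorProduct A B :=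
  (u : Completion (AlgebraicProjectiveTensor A B))

theorem continuous_ofAlgebraic : Continuous (ofAlgebraic (A := A) (B := B)) :=
  Completion.continuous_coe _

theorem isDenseInducing_ofAlgebraic : IsDenseInducing (ofAlgebraic (A := A) (B := B)) :=
  Completion.isDenseInducing_coe

theorem norm_ofAlgebraic (u : AlgebraicProjectiveTensor A B) : ‖ofAlgebraic u‖ = ‖u‖ :=
  Completion.norm_coe u

theorem ofAlgebraic_add (u v : AlgebraicProjectiveTensor A B) :
    ofAlgebraic (u + v) = ofAlgebraic u + ofAlgebraic v := Completion.coe_add u v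

theorem ofAlgebraic_smul (c : ℂ) (u : AlgebraicProjectiveTensor A B) :
    ofAlgebraic (c • u) = c • ofAlgebraic u := Completion.coe_smul c u

@[elab_as_elim]
theorem induction_on {p : ProjectiveTensorProduct A B → Prop} (x : ProjectiveTensorProduct A B)
    (hp : IsClosed {x | p x}) (h : ∀ u, p (ofAlgebraic u)) : p x :=
  isDenseInducing_ofAlgebraic.dense.induction_on x hp h

variable [IsScalarTower ℂ A A] [SMulCommClass ℂ A A] [IsScalarTower ℂ B B] [SMulCommClass ℂ B B]

/-- The multiplication, which extends that of the algebraic tensor product,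
`(a ⊗ b) * (a' ⊗ b') = (a * a') ⊗ (b * b')`, by continuity. -/
@[irreducible]
noncomputable def mulExtension (x y : ProjectiveTensorProduct A B) : ProjectiveTensorProduct A B :=
  (isDenseInducing_ofAlgebraic.prodMap isDenseInducing_ofAlgebraic).extend
    (fun p => ofAlgebraic (p.1 * p.2)) (x, y)

noncomputable instance : Mul (ProjectiveTensorProduct A B) :=
  ⟨mulExtension⟩

theorem mul_eq_extend (x y : ProjectiveTensorProduct A B) :
    x * y = (isDenseInducing_ofAlgebraic.prodMap isDenseInducing_ofAlgebraic).extend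
      (fun p => ofAlgebraic (p.1 * p.2)) (x, y) := by
  change mulExtension x y = _
  rw [mulExtension]

theorem ofAlgebraic_mul (u v : AlgebraicProjectiveTensor A B) :
    ofAlgebraic (u * v) = ofAlgebraic u * ofAlgebraic v := by
  rw [mul_eq_extend]
  exact ((isDenseInducing_ofAlgebraic.prodMap isDenseInducing_ofAlgebraic).extend_eq
    (continuous_ofAlgebraic.comp continuous_mul) (u, v)).symm

instance : ContinuousMul (ProjectiveTensorProduct A B) where
  continuous_mul := by
    let m := (AddMonoidHom.mul (R := AlgebraicProjectiveTensor A B)).compr₂ Completion.toCompl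
    have : Continuous fun p : AlgebraicProjectiveTensor A B × AlgebraicProjectiveTensor A B =>
        m p.1 p.2 := (Completion.continuous_coe _).comp continuous_mul
    have di : IsDenseInducing (Completion.toCompl :
        AlgebraicProjectiveTensor A B → Completion (AlgebraicProjectiveTensor A B)) :=
      Completion.isDenseInducing_coe
    simp only [mul_eq_extend]
    exact di.extend_Z_bilin di this

theorem left_distrib_aux (x y z : ProjectiveTensorProduct A B) :
    x * (y + z) = x * y + x * z := by
  refine induction_on x (isClosed_eq (by fun_prop) (by fun_prop)) fun u => ?_
  refine induction_on y (isClosed_eq (by fun_prop) (by fun_prop)) fun v => ?_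
  refine induction_on z (isClosed_eq (by fun_prop) (by fun_prop)) fun w => ?_
  simp only [← ofAlgebraic_mul, ← ofAlgebraic_add, mul_add]

theorem right_distrib_aux (x y z : ProjectiveTensorProduct A B) :
    (x + y) * z = x * z + y * z := by
  refine induction_on x (isClosed_eq (by fun_prop) (by fun_prop)) fun u => ?_
  refine induction_on y (isClosed_eq (by fun_prop) (by fun_prop)) fun v => ?_
  refine induction_on z (isClosed_eq (by fun_prop) (by fun_prop)) fun w => ?_
  simp only [← ofAlgebraic_mul, ← ofAlgebraic_add, add_mul]

theorem mul_assoc_aux (x y z : ProjectiveTensorProduct A B) :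
    x * y * z = x * (y * z) := by
  refine induction_on x (isClosed_eq (by fun_prop) (by fun_prop)) fun u => ?_
  refine induction_on y (isClosed_eq (by fun_prop) (by fun_prop)) fun v => ?_
  refine induction_on z (isClosed_eq (by fun_prop) (by fun_prop)) fun w => ?_
  simp only [← ofAlgebraic_mul, mul_assoc]

theorem norm_mul_le_aux (x y : ProjectiveTensorProduct A B) :
    ‖x * y‖ ≤ ‖x‖ * ‖y‖ := by
  refine induction_on x (isClosed_le (by fun_prop) (by fun_prop)) fun u => ?_
  refine induction_on y (isClosed_le (by fun_prop) (by fun_prop)) fun v => ?_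
  simpa only [← ofAlgebraic_mul, norm_ofAlgebraic] using norm_mul_le u v

theorem smul_mul_aux (c : ℂ) (x y : ProjectiveTensorProduct A B) :
    (c • x) * y = c • (x * y) := by
  refine induction_on x (isClosed_eq ((continuous_const_smul c).mul continuous_const)
    ((continuous_id.mul continuous_const).const_smul c)) fun u => ?_
  refine induction_on y (isClosed_eq (continuous_const.mul continuous_id)
    ((continuous_const.mul continuous_id).const_smul c)) fun v => ?_
  rw [← ofAlgebraic_mul, ← ofAlgebraic_smul, ← ofAlgebraic_smul, ← ofAlgebraic_mul, smul_mul_assoc]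

theorem mul_smul_aux (c : ℂ) (x y : ProjectiveTensorProduct A B) :
    x * (c • y) = c • (x * y) := by
  refine induction_on x (isClosed_eq (continuous_id.mul continuous_const)
    ((continuous_id.mul continuous_const).const_smul c)) fun u => ?_
  refine induction_on y (isClosed_eq (continuous_const.mul (continuous_const_smul c))
    ((continuous_const.mul continuous_id).const_smul c)) fun v => ?_
  rw [← ofAlgebraic_mul, ← ofAlgebraic_smul, ← ofAlgebraic_smul, ← ofAlgebraic_mul, mul_smul_comm]

theorem zero_mul_aux (x : ProjectiveTensorProduct A B) : 0 * x = 0 := by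
  have h := right_distrib_aux 0 0 x
  rw [add_zero] at h
  exact left_eq_add.mp h

theorem mul_zero_aux (x : ProjectiveTensorProduct A B) : x * 0 = 0 := by
  have h := left_distrib_aux x 0 0
  rw [add_zero] at h
  exact left_eq_add.mp h

noncomputable instance : NonUnitalNormedRing (ProjectiveTensorProduct A B) where
  __ := (inferInstance : NormedAddCommGroup (ProjectiveTensorProduct A B))
  __ := (inferInstance : Mul (ProjectiveTensorProduct A B))
  left_distrib := left_distrib_aux
  right_distrib := right_distrib_aux
  zero_mul := zero_mul_aux
  mul_zero := mul_zero_aux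
  mul_assoc := mul_assoc_aux
  norm_mul_le := norm_mul_le_aux

instance : IsScalarTower ℂ (ProjectiveTensorProduct A B) (ProjectiveTensorProduct A B) where
  smul_assoc := smul_mul_aux

instance : SMulCommClass ℂ (ProjectiveTensorProduct A B) (ProjectiveTensorProduct A B) where
  smul_comm c x y := (mul_smul_aux c x y).symm

end ProjectiveTensorProduct

end ProjectiveTensorProduct

section Beurling

set_option linter.unusedSectionVars false

open MeasureTheory
open scoped ENNReal

/-- A weight function on a topological group: a continuous submultiplicative function with values
in `[1, ∞)` and value `1` at the identity. -/
structure WeightFunction (G : Type*) [Group G] [TopologicalSpace G] where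
  toFun : G → ℝ
  continuous_toFun : Continuous toFun
  one_le : ∀ x, 1 ≤ toFun x
  map_mul_le : ∀ x y, toFun (x * y) ≤ toFun x * toFun y
  map_one : toFun 1 = 1

instance {G : Type*} [Group G] [TopologicalSpace G] : CoeFun (WeightFunction G) fun _ => G → ℝ :=
  ⟨WeightFunction.toFun⟩

variable {G : Type*} [Group G] [TopologicalSpace G] [MeasurableSpace G]

/-- The measure `ω(x) dμ(x)`. -/
noncomputable def weightedMeasure (μ : Measure G) (ω : WeightFunction G) : Measure G :=
  μ.withDensity fun x => ENNReal.ofReal (ω x)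

/-- The convolution `(f * g)(x) = ∫ f(y) g(y⁻¹ x) dμ(y)`. -/
noncomputable def groupConvolution (μ : Measure G) (f g : G → ℂ) (x : G) : ℂ :=
  ∫ y, f y * g (y⁻¹ * x) ∂μ

namespace BeurlingAux

open Filter Topology Set Function
open scoped Pointwise

theorem weight_pos (ω : WeightFunction G) (x : G) : 0 < ω x :=
  zero_lt_one.trans_le (ω.one_le x)

variable [BorelSpace G]

theorem measurable_density (ω : WeightFunction G) :
    Measurable fun x => ENNReal.ofReal (ω x) :=
  ω.continuous_toFun.measurable.ennreal_ofReal

theorem weighted_ac (μ : Measure G) (ω : WeightFunction G) : weightedMeasure μ ω ≪ μ :=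
  withDensity_absolutelyContinuous _ _

theorem ac_weighted (μ : Measure G) (ω : WeightFunction G) : μ ≪ weightedMeasure μ ω :=
  withDensity_absolutelyContinuous' (measurable_density ω).aemeasurable
    (Eventually.of_forall fun x => by simpa using weight_pos ω x)

theorem ae_weighted (μ : Measure G) (ω : WeightFunction G) : ae (weightedMeasure μ ω) = ae μ :=
  le_antisymm (weighted_ac μ ω).ae_le (ac_weighted μ ω).ae_le

theorem lintegral_weighted (μ : Measure G) (ω : WeightFunction G) (f : G → ℝ≥0∞) :
    ∫⁻ x, f x ∂(weightedMeasure μ ω) = ∫⁻ x, ENNReal.ofReal (ω x) * f x ∂μ :=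
  lintegral_withDensity_eq_lintegral_mul_non_measurable μ (measurable_density ω)
    (Eventually.of_forall fun _ => ENNReal.ofReal_lt_top) f

theorem lintegral_le_weighted (μ : Measure G) (ω : WeightFunction G) (f : G → ℝ≥0∞) :
    ∫⁻ x, f x ∂μ ≤ ∫⁻ x, f x ∂(weightedMeasure μ ω) := by
  rw [lintegral_weighted]
  refine lintegral_mono fun x => ?_
  have : 1 ≤ ENNReal.ofReal (ω x) := by simpa using ω.one_le x
  exact le_mul_of_one_le_left zero_le this

theorem integrable_weighted_iff (μ : Measure G) (ω : WeightFunction G) {f : G → ℂ} :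
    Integrable f (weightedMeasure μ ω) ↔ Integrable (fun x => ω x • f x) μ := by
  rw [weightedMeasure, integrable_withDensity_iff_integrable_smul' (measurable_density ω)
    (Eventually.of_forall fun _ => ENNReal.ofReal_lt_top)]
  simp only [ENNReal.toReal_ofReal (weight_pos ω _).le]

/-- Continuous functions with compact support. -/
def IsCc (f : G → ℂ) : Prop := Continuous f ∧ HasCompactSupport f

variable {μ : Measure G} {ω : WeightFunction G}

theorem IsCc.integrable [IsFiniteMeasureOnCompacts μ] {f : G → ℂ} (hf : IsCc f) :
    Integrable f μ :=
  hf.1.integrable_of_hasCompactSupport hf.2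

theorem IsCc.weighted_integrable [IsFiniteMeasureOnCompacts μ] {f : G → ℂ} (hf : IsCc f) :
    Integrable f (weightedMeasure μ ω) :=
  (integrable_weighted_iff μ ω).2
    ((ω.continuous_toFun.smul hf.1).integrable_of_hasCompactSupport hf.2.smul_left)

theorem IsCc.sub {f g : G → ℂ} (hf : IsCc f) (hg : IsCc g) : IsCc (f - g) :=
  ⟨hf.1.sub hg.1, hf.2.sub hg.2⟩

theorem enorm_weight_smul (c : G) (z : ℂ) : ‖ω c • z‖ₑ = ENNReal.ofReal (ω c) * ‖z‖ₑ := by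
  rw [enorm_smul, Real.enorm_eq_ofReal (weight_pos ω c).le]

variable [IsTopologicalGroup G] [LocallyCompactSpace G]

theorem exists_approx_haar [μ.Regular] {f : G → ℂ} (hf : Integrable f μ) {ε : ℝ≥0∞}
    (hε : ε ≠ 0) : ∃ φ, IsCc φ ∧ ∫⁻ x, ‖f x - φ x‖ₑ ∂μ ≤ ε := by
  suffices H : ∀ (c : ℂ) ⦃t : Set G⦄, MeasurableSet t → μ t < ∞ → ∀ {ε : ℝ≥0∞}, ε ≠ 0 →
      ∃ g : G → ℂ, eLpNorm (g - t.indicator fun _ => c) 1 μ ≤ ε ∧ IsCc g by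
    obtain ⟨g, h1, h2⟩ := MemLp.induction_dense ENNReal.one_ne_top (IsCc (G := G)) H
      (fun f g hf hg => ⟨hf.1.add hg.1, hf.2.add hg.2⟩) (fun f hf => hf.integrable.1)
      (memLp_one_iff_integrable.2 hf) hε
    exact ⟨g, h2, by simpa [eLpNorm_one_eq_lintegral_enorm] using h1⟩
  intro c t ht htμ ε hε
  have hη : (ε / (‖c‖ₑ + 1)) / 2 ≠ 0 := by
    simp [ENNReal.div_eq_zero_iff, hε]
  set η := (ε / (‖c‖ₑ + 1)) / 2
  obtain ⟨s, st, s_compact, s_closed, μs⟩ := ht.exists_isCompact_isClosed_sdiff_lt htμ.ne hη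
  obtain ⟨U, tU, hU, -, hUμ⟩ := ht.exists_isOpen_sdiff_lt htμ.ne hη
  obtain ⟨f, f1, f0, fc, fI⟩ := exists_continuous_one_zero_of_isCompact s_compact
    hU.isClosed_compl (disjoint_compl_right_iff_subset.2 (st.trans tU))
  refine ⟨fun x => f x • c, ?_, by fun_prop, fc.smul_right⟩
  rw [eLpNorm_one_eq_lintegral_enorm]
  calc ∫⁻ x, ‖((fun x => f x • c) - t.indicator fun _ => c) x‖ₑ ∂μ
      ≤ ∫⁻ x, (U \ t ∪ t \ s).indicator (fun _ => ‖c‖ₑ) x ∂μ := by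
        refine lintegral_mono fun x => ?_
        have hI := fI x
        by_cases hxU : x ∈ U
        · by_cases hxs : x ∈ s
          · have := f1 hxs
            simp only [Pi.one_apply] at this
            simp [this, st hxs]
          · have hmem : x ∈ U \ t ∪ t \ s := by
              by_cases hxt : x ∈ t
              · exact Or.inr ⟨hxt, hxs⟩
              · exact Or.inl ⟨hxU, hxt⟩
            rw [indicator_of_mem hmem, enorm_le_iff_norm_le]
            by_cases hxt : x ∈ t
            · have e : ((fun x => f x • c) - t.indicator fun _ => c) x = (f x - 1) • c := by
                simp [hxt, sub_smul]
              rw [e, norm_smul]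
              refine mul_le_of_le_one_left (norm_nonneg _) ?_
              rw [Real.norm_eq_abs, abs_le]
              constructor <;> linarith [hI.1, hI.2]
            · have e : ((fun x => f x • c) - t.indicator fun _ => c) x = f x • c := by
                simp [hxt]
              rw [e, norm_smul]
              refine mul_le_of_le_one_left (norm_nonneg _) ?_
              rw [Real.norm_eq_abs, abs_le]
              constructor <;> linarith [hI.1, hI.2]
        · have hxt : x ∉ t := fun h => hxU (tU h)
          have := f0 (show x ∈ Uᶜ from hxU)
          simp only [Pi.zero_apply] at this
          simp [this, hxt]
    _ ≤ ‖c‖ₑ * μ (U \ t ∪ t \ s) := lintegral_indicator_const_le _ _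
    _ ≤ ‖c‖ₑ * (η + η) := by
        gcongr
        exact (measure_union_le _ _).trans (add_le_add hUμ.le μs.le)
    _ = ‖c‖ₑ * (ε / (‖c‖ₑ + 1)) := by rw [ENNReal.add_halves]
    _ ≤ (‖c‖ₑ + 1) * (ε / (‖c‖ₑ + 1)) := by
        gcongr
        exact le_self_add
    _ ≤ ε := ENNReal.mul_div_le

theorem exists_approx [μ.Regular] {f : G → ℂ} (hf : Integrable f (weightedMeasure μ ω))
    {ε : ℝ≥0∞} (hε : ε ≠ 0) :
    ∃ φ, IsCc φ ∧ ∫⁻ x, ‖f x - φ x‖ₑ ∂(weightedMeasure μ ω) ≤ ε := by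
  obtain ⟨h, ⟨h3, h1⟩, h2⟩ := exists_approx_haar ((integrable_weighted_iff μ ω).1 hf) hε
  refine ⟨fun x => (ω x)⁻¹ • h x, ⟨?_, h1.smul_left (f := fun x => (ω x)⁻¹)⟩, ?_⟩
  · exact (ω.continuous_toFun.inv₀ fun x => (weight_pos ω x).ne').smul h3
  · rw [lintegral_weighted]
    refine le_trans (le_of_eq (lintegral_congr fun x => ?_)) h2
    rw [← enorm_weight_smul, smul_sub, smul_inv_smul₀ (weight_pos ω x).ne']

/-- Integrable functions are absolutely convergent series of continuous functions with compact
support, with good control of the sum of the norms. -/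
theorem exists_series [μ.Regular] {f : G → ℂ} (hf : Integrable f (weightedMeasure μ ω))
    {ε : ℝ≥0∞} (hε : ε ≠ 0) (hε' : ε ≠ ∞) :
    ∃ φ : ℕ → G → ℂ, (∀ n, IsCc (φ n)) ∧
      ∑' n, ∫⁻ x, ‖φ n x‖ₑ ∂(weightedMeasure μ ω) ≤
        ∫⁻ x, ‖f x‖ₑ ∂(weightedMeasure μ ω) + ε ∧
      ∀ᵐ x ∂μ, Summable (fun n => ‖φ n x‖) ∧ HasSum (fun n => φ n x) (f x) := by
  set ν := weightedMeasure μ ω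
  obtain ⟨δ, δpos, hδ⟩ := ENNReal.exists_pos_sum_of_countable' (ENNReal.half_pos hε).ne' ℕ
  choose ψ hψ hψ' using fun n => exists_approx hf (δpos n).ne'
  let φ : ℕ → G → ℂ := fun n => Nat.casesOn n (ψ 0) fun k => ψ (k + 1) - ψ k
  have hφ : ∀ n, IsCc (φ n) := by
    rintro (_ | n)
    · exact hψ 0
    · exact (hψ (n + 1)).sub (hψ n)
  have hsum : ∀ n x, ∑ i ∈ Finset.range (n + 1), φ i x = ψ n x := by
    intro n x
    induction n with
    | zero => simp [φ]
    | succ n ih => rw [Finset.sum_range_succ, ih]; simp [φ]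
  have hm : ∀ n, AEMeasurable (fun x => ‖f x - ψ n x‖ₑ) ν := fun n =>
    (hf.1.sub (hψ n).weighted_integrable.1).enorm
  have h0 : ∫⁻ x, ‖φ 0 x‖ₑ ∂ν ≤ ∫⁻ x, ‖f x‖ₑ ∂ν + δ 0 := by
    calc ∫⁻ x, ‖φ 0 x‖ₑ ∂ν ≤ ∫⁻ x, (‖f x‖ₑ + ‖f x - ψ 0 x‖ₑ) ∂ν := by
          refine lintegral_mono fun x => ?_
          have : φ 0 x = f x - (f x - ψ 0 x) := by simp [φ]
          rw [this]
          exact enorm_sub_le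
      _ ≤ _ := by
          rw [lintegral_add_right' _ (hm 0)]
          gcongr
          exact hψ' 0
  have hs : ∀ n, ∫⁻ x, ‖φ (n + 1) x‖ₑ ∂ν ≤ δ n + δ (n + 1) := by
    intro n
    calc ∫⁻ x, ‖φ (n + 1) x‖ₑ ∂ν ≤ ∫⁻ x, (‖f x - ψ n x‖ₑ + ‖f x - ψ (n + 1) x‖ₑ) ∂ν := by
          refine lintegral_mono fun x => ?_
          have : φ (n + 1) x = (f x - ψ n x) - (f x - ψ (n + 1) x) := by simp [φ]
          rw [this]
          exact enorm_sub_le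
      _ ≤ _ := by
          rw [lintegral_add_right' _ (hm _)]
          gcongr
          · exact hψ' n
          · exact hψ' (n + 1)
  have htot : ∑' n, ∫⁻ x, ‖φ n x‖ₑ ∂ν ≤ ∫⁻ x, ‖f x‖ₑ ∂ν + ε := by
    rw [tsum_eq_zero_add' ENNReal.summable]
    calc _ ≤ (∫⁻ x, ‖f x‖ₑ ∂ν + δ 0) + ∑' n, (δ n + δ (n + 1)) := by
          gcongr with n
          exact hs n
      _ = ∫⁻ x, ‖f x‖ₑ ∂ν + (∑' n, δ n + ∑' n, δ n) := by
          rw [ENNReal.tsum_add]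
          nth_rw 3 [tsum_eq_zero_add' ENNReal.summable]
          ring
      _ ≤ ∫⁻ x, ‖f x‖ₑ ∂ν + (ε / 2 + ε / 2) := by gcongr
      _ = _ := by rw [ENNReal.add_halves]
  refine ⟨φ, hφ, htot, ?_⟩
  have hfin : ∑' n, ∫⁻ x, ‖φ n x‖ₑ ∂ν ≠ ∞ :=
    ne_top_of_le_ne_top (ENNReal.add_ne_top.2 ⟨hf.2.ne, hε'⟩) htot
  rw [← lintegral_tsum fun n => (hφ n).weighted_integrable.1.enorm] at hfin
  have hfin2 : ∫⁻ x, ∑' n, ‖f x - ψ n x‖ₑ ∂ν ≠ ∞ := by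
    rw [lintegral_tsum hm]
    exact ne_top_of_le_ne_top (hδ.trans_le le_top).ne (ENNReal.tsum_le_tsum hψ')
  have a1 := ae_lt_top' (AEMeasurable.tsum fun n => (hφ n).weighted_integrable.1.enorm) hfin
  have a2 := ae_lt_top' (AEMeasurable.tsum hm) hfin2
  rw [ae_weighted] at a1 a2
  filter_upwards [a1, a2] with x h1 h2
  have hsumm : Summable fun n => ‖φ n x‖ := by
    have := ENNReal.summable_toReal h1.ne
    simpa using this
  refine ⟨hsumm, ?_⟩
  have ht := ENNReal.tendsto_atTop_zero_of_tsum_ne_top h2.ne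
  have ht2 : Tendsto (fun n => ψ n x) atTop (𝓝 (f x)) := by
    rw [tendsto_iff_edist_tendsto_0]
    refine ht.congr fun n => ?_
    rw [edist_comm, edist_eq_enorm_sub]
  have hS := hsumm.of_norm.hasSum
  have := (tendsto_add_atTop_iff_nat 1).2 hS.tendsto_sum_nat
  simp only [hsum] at this
  rwa [tendsto_nhds_unique this ht2] at hS

/-- Summing a series of integrable functions. -/
theorem series_lemma {X : Type*} [MeasurableSpace X] {ρ : Measure X} {k : ℕ × ℕ → X → ℂ}
    {h : X → ℂ} (hk : ∀ p, Integrable (k p) ρ) (hfin : ∑' p, ∫⁻ x, ‖k p x‖ₑ ∂ρ ≠ ∞)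
    (hs : ∀ᵐ x ∂ρ, HasSum (fun p => k p x) (h x)) :
    Integrable h ρ ∧ HasSum (fun p => ∫ x, k p x ∂ρ) (∫ x, h x ∂ρ) ∧
      ∫⁻ x, ‖h x‖ₑ ∂ρ ≤ ∑' p, ∫⁻ x, ‖k p x‖ₑ ∂ρ := by
  have hle : ∫⁻ x, ‖h x‖ₑ ∂ρ ≤ ∑' p, ∫⁻ x, ‖k p x‖ₑ ∂ρ := by
    rw [← lintegral_tsum fun p => (hk p).1.enorm]
    refine lintegral_mono_ae ?_
    filter_upwards [hs] with x hx
    rw [← hx.tsum_eq]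
    exact enorm_tsum_le_tsum_enorm
  have hmeas : AEStronglyMeasurable h ρ :=
    aestronglyMeasurable_of_tendsto_ae (u := (atTop : Filter (Finset (ℕ × ℕ))))
      (f := fun s x => ∑ p ∈ s, k p x)
      (fun s => Finset.aestronglyMeasurable_fun_sum s fun p _ => (hk p).1) hs
  refine ⟨⟨hmeas, hle.trans_lt hfin.lt_top⟩, ?_, hle⟩
  have hsum : Summable fun p => ∫ x, ‖k p x‖ ∂ρ := by
    have := ENNReal.summable_toReal hfin
    refine this.congr fun p => ?_
    rw [integral_norm_eq_lintegral_enorm (hk p).1]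
  have := hasSum_integral_of_summable_integral_norm hk hsum
  rwa [integral_congr_ae (g := h)] at this
  filter_upwards [hs] with x hx using hx.tsum_eq

section Inversion

variable [μ.IsHaarMeasure] [μ.Regular]

theorem compact_inv_null {C : Set G} (hC : IsCompact C) (h0 : μ C = 0) : μ C⁻¹ = 0 := by
  rw [← Measure.inv_apply]
  set ν := μ.inv with hν
  obtain ⟨⟨g, g_cont⟩, g_comp, g_nonneg, g_one⟩ :
    ∃ g : C(G, ℝ), HasCompactSupport g ∧ 0 ≤ (g : G → ℝ) ∧ g 1 ≠ 0 := exists_continuous_nonneg_pos 1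
  simp only [ContinuousMap.coe_mk] at g_comp g_nonneg g_one
  have I_pos : 0 < ∫ x, g x ∂μ :=
    g_cont.integral_pos_of_hasCompactSupport_nonneg_nonzero g_comp g_nonneg g_one
  set I := ∫ x, g x ∂μ with hI
  let D : G → ℝ := fun y => ∫ z, g (z⁻¹ * y) ∂ν
  have D_cont : Continuous D := continuous_integral_apply_inv_mul g_cont g_comp
  have D_pos : ∀ x, 0 < D x := by
    intro x
    have Cc : Continuous (fun y ↦ g (y⁻¹ * x)) := by fun_prop
    apply (integral_pos_iff_support_of_nonneg _ _).2
    · apply Cc.isOpen_support.measure_pos ν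
      exact ⟨x, by simpa using g_one⟩
    · exact fun y ↦ g_nonneg (y⁻¹ * x)
    · apply Cc.integrable_of_hasCompactSupport
      exact g_comp.comp_homeomorph ((Homeomorph.inv G).trans (Homeomorph.mulRight x))
  obtain ⟨h, h1, -, h_comp, hI01⟩ := exists_continuous_one_zero_of_isCompact hC isClosed_empty
    (disjoint_empty C)
  obtain ⟨M, hM⟩ : ∃ M, ∀ y ∈ tsupport h, D y ≤ M := by
    obtain ⟨M, hM⟩ := (IsCompact.image (f := D) h_comp D_cont).bddAbove
    exact ⟨M, fun y hy => hM (mem_image_of_mem _ hy)⟩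
  have key : ∀ f : G → ℝ, Continuous f → HasCompactSupport f → EqOn f 1 C → 0 ≤ f →
      ν C ≤ ENNReal.ofReal (M / I) * ENNReal.ofReal (∫ x, f x ∂μ) := by
    intro f f_cont f_comp f1 f_nonneg
    have fh_cont : Continuous fun x => f x * h x := f_cont.mul h.continuous
    have fh_comp : HasCompactSupport fun x => f x * h x := f_comp.mul_right
    have fh_nonneg : ∀ x, 0 ≤ f x * h x := fun x => mul_nonneg (f_nonneg x) (hI01 x).1
    have le1 : ν C ≤ ENNReal.ofReal (∫ x, f x * h x ∂ν) := by
      rw [hC.measure_eq_biInf_integral_hasCompactSupport ν]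
      refine iInf_le_of_le (fun x => f x * h x) (iInf_le_of_le fh_cont (iInf_le_of_le fh_comp
        (iInf_le_of_le ?_ (iInf_le_of_le (fun x => fh_nonneg x) le_rfl))))
      intro x hx
      have := f1 hx
      have := h1 hx
      simp_all
    have Dinv_cont : Continuous fun x => f x * h x * (D x)⁻¹ :=
      fh_cont.mul (D_cont.inv₀ fun x => (D_pos x).ne')
    have le2 : ∫ x, f x * h x ∂ν ≤ M * ∫ x, f x * h x * (D x)⁻¹ ∂ν := by
      rw [← integral_const_mul]
      refine integral_mono (fh_cont.integrable_of_hasCompactSupport fh_comp)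
        ((Dinv_cont.integrable_of_hasCompactSupport fh_comp.mul_right).const_mul M) fun x => ?_
      by_cases hx : x ∈ tsupport h
      · have hD := hM x hx
        have e : M * (f x * h x * (D x)⁻¹) = (f x * h x) * (M * (D x)⁻¹) := by ring
        simp only [e]
        refine le_mul_of_one_le_right (fh_nonneg x) ?_
        rw [← div_eq_mul_inv, one_le_div (D_pos x)]
        exact hD
      · simp [image_eq_zero_of_notMem_tsupport hx]
    have combo := Measure.integral_isMulLeftInvariant_isMulRightInvariant_combo (μ := μ) (ν := ν)
      fh_cont fh_comp g_cont g_comp g_nonneg g_one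
    have M_nonneg : 0 ≤ M ∨ ∀ x, h x = 0 := by
      by_cases hx : ∃ x, h x ≠ 0
      · obtain ⟨x, hx⟩ := hx
        exact Or.inl ((D_pos x).le.trans (hM x (subset_tsupport _ hx)))
      · exact Or.inr (by simpa using hx)
    rcases M_nonneg with M_nonneg | hz
    · have le3 : ∫ x, f x * h x ∂μ ≤ ∫ x, f x ∂μ := by
        refine integral_mono (fh_cont.integrable_of_hasCompactSupport fh_comp)
          (f_cont.integrable_of_hasCompactSupport f_comp) fun x => ?_
        exact mul_le_of_le_one_right (f_nonneg x) (hI01 x).2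
      refine le1.trans ?_
      rw [← ENNReal.ofReal_mul (by positivity)]
      refine ENNReal.ofReal_le_ofReal (le2.trans ?_)
      have e : ∫ x, f x * h x * (D x)⁻¹ ∂ν = (∫ x, f x * h x ∂μ) / I := by
        rw [combo, mul_div_cancel_right₀ _ I_pos.ne']
      rw [e]
      calc M * ((∫ x, f x * h x ∂μ) / I) = M / I * ∫ x, f x * h x ∂μ := by ring
        _ ≤ _ := by gcongr
    · refine le1.trans ?_
      simp [hz]
  by_contra hne
  set A := ENNReal.ofReal (M / I)
  have hr : μ C < ν C / (A + 1) := by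
    rw [h0]
    exact ENNReal.div_pos hne (by simp [A])
  rw [hC.measure_eq_biInf_integral_hasCompactSupport μ] at hr
  simp only [iInf_lt_iff] at hr
  obtain ⟨f, hf1, hf2, hf3, hf4, hlt⟩ := hr
  have h2 := key f hf1 hf2 hf3 hf4
  rw [ENNReal.lt_div_iff_mul_lt (by simp) (by simp [A])] at hlt
  refine absurd (hlt.trans_le h2) (not_lt.2 ?_)
  rw [mul_comm]
  gcongr
  exact le_self_add

theorem local_inv_null {E K : Set G} (hE : μ E = 0) (hK : IsCompact K) : μ (E⁻¹ ∩ K) = 0 := by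
  have hsub : E⁻¹ ∩ K ⊆ (toMeasurable μ E)⁻¹ ∩ closure K :=
    inter_subset_inter (inv_subset_inv.2 (subset_toMeasurable μ E)) subset_closure
  refine measure_mono_null hsub ?_
  by_contra hne
  have hm : MeasurableSet ((toMeasurable μ E)⁻¹ ∩ closure K) :=
    (measurableSet_toMeasurable μ E).inv.inter isClosed_closure.measurableSet
  obtain ⟨C, hCS, hC, hpos⟩ := hm.exists_lt_isCompact_of_ne_top
    (measure_mono inter_subset_right |>.trans_lt hK.closure.measure_lt_top).ne
    (pos_iff_ne_zero.2 hne)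
  refine hpos.ne' ?_
  have : μ C⁻¹ = 0 := by
    refine measure_mono_null (t := toMeasurable μ E) ?_ (by rwa [measure_toMeasurable])
    intro x hx
    simpa using (hCS hx).1
  simpa using compact_inv_null hC.inv this

theorem ae_translate {P : G → Prop} (h : ∀ᵐ z ∂μ, P z) {K : ℕ → Set G}
    (hK : ∀ n, IsCompact (K n)) (x : G) : ∀ᵐ y ∂μ, y ∈ ⋃ n, K n → P (y⁻¹ * x) := by
  have hn : ∀ n, ∀ᵐ y ∂μ, y ∈ K n → P (y⁻¹ * x) := by
    intro n
    have h1 := local_inv_null (μ := μ) (E := {z | ¬ P z}) h ((hK n).smul x⁻¹)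
    rw [← measure_preimage_mul μ x⁻¹] at h1
    refine measure_mono_null ?_ h1
    intro y hy
    simp only [mem_compl_iff, mem_ofPred_eq, Classical.not_imp] at hy
    refine ⟨?_, ?_⟩
    · simpa using hy.2
    · exact ⟨y, hy.1, by simp⟩
  filter_upwards [ae_all_iff.2 hn] with y hy hmem
  obtain ⟨n, hn⟩ := mem_iUnion.1 hmem
  exact hy n hn

end Inversion

section CompactSupport

theorem kernel_compact {R : Type*} [NormedRing R] {a b : G → R} (ha : HasCompactSupport a)
    (hb : HasCompactSupport b) :
    HasCompactSupport fun p : G × G => a p.1 * b (p.1⁻¹ * p.2) := by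
  have h : HasCompactSupport fun p : G × G => a p.1 * b p.2 := by
    refine HasCompactSupport.intro' (IsCompact.prod ha hb)
      ((isClosed_tsupport a).prod (isClosed_tsupport b)) fun p hp => ?_
    by_cases h1 : p.1 ∈ tsupport a
    · have h2 : p.2 ∉ tsupport b := fun h2 => hp ⟨h1, h2⟩
      simp [image_eq_zero_of_notMem_tsupport h2]
    · simp [image_eq_zero_of_notMem_tsupport h1]
  exact h.comp_homeomorph (Homeomorph.shearMulRight G).symm

theorem kernel_compact_left {R : Type*} [NormedRing R] {a b : G → R} (ha : HasCompactSupport a)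
    (x : G) : HasCompactSupport fun y => a y * b (y⁻¹ * x) :=
  ha.mul_right

theorem convolution_compact [IsFiniteMeasureOnCompacts μ] {𝕜 : Type*} [RCLike 𝕜] {a b : G → 𝕜}
    (ha : Continuous a) (ha' : HasCompactSupport a) (hb : Continuous b)
    (hb' : HasCompactSupport b) :
    Continuous (fun x => ∫ y, a y * b (y⁻¹ * x) ∂μ) ∧
      HasCompactSupport (fun x => ∫ y, a y * b (y⁻¹ * x) ∂μ) := by
  constructor
  · rw [← continuousOn_univ]
    refine continuousOn_integral_of_compact_support (k := tsupport a) ha' ?_ ?_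
    · exact Continuous.continuousOn (by fun_prop)
    · intro p y _ hy
      simp [image_eq_zero_of_notMem_tsupport hy]
  · refine HasCompactSupport.intro (K := tsupport a * tsupport b) (IsCompact.mul ha' hb')
      fun x hx => ?_
    refine integral_eq_zero_of_ae (Eventually.of_forall fun y => ?_)
    by_cases h1 : y ∈ tsupport a
    · have h2 : y⁻¹ * x ∉ tsupport b := fun h2 => hx ⟨y, h1, y⁻¹ * x, h2, by simp⟩
      simp [image_eq_zero_of_notMem_tsupport h2]
    · simp [image_eq_zero_of_notMem_tsupport h1]

theorem IsCc.convolution [IsFiniteMeasureOnCompacts μ] {φ ψ : G → ℂ} (hφ : IsCc φ)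
    (hψ : IsCc ψ) : IsCc (groupConvolution μ φ ψ) :=
  convolution_compact hφ.1 hφ.2 hψ.1 hψ.2

theorem IsCc.kernel {φ ψ : G → ℂ} (hφ : IsCc φ) (hψ : IsCc ψ) (x : G) :
    IsCc fun y => φ y * ψ (y⁻¹ * x) := by
  have := hφ.1
  have := hψ.1
  exact ⟨by fun_prop, kernel_compact_left hφ.2 x⟩

variable [μ.IsHaarMeasure]

theorem IsCc.lintegral_eq {φ : G → ℂ} (hφ : IsCc φ) :
    ∫⁻ x, ‖φ x‖ₑ ∂(weightedMeasure μ ω) = ENNReal.ofReal (∫ x, ω x * ‖φ x‖ ∂μ) := by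
  rw [lintegral_weighted, ofReal_integral_eq_lintegral_ofReal]
  · refine lintegral_congr fun x => ?_
    rw [ENNReal.ofReal_mul (weight_pos ω x).le, ofReal_norm]
  · exact (ω.continuous_toFun.mul hφ.1.norm).integrable_of_hasCompactSupport hφ.2.norm.mul_left
  · exact Eventually.of_forall fun x => mul_nonneg (weight_pos ω x).le (norm_nonneg _)

/-- The norm estimate for convolutions of continuous functions with compact support. -/
theorem IsCc.lintegral_kernel_le {φ ψ : G → ℂ} (hφ : IsCc φ) (hψ : IsCc ψ) :
    ∫⁻ x, ∫⁻ y, ‖φ y * ψ (y⁻¹ * x)‖ₑ ∂μ ∂(weightedMeasure μ ω) ≤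
      (∫⁻ x, ‖φ x‖ₑ ∂(weightedMeasure μ ω)) * ∫⁻ x, ‖ψ x‖ₑ ∂(weightedMeasure μ ω) := by
  have hω := ω.continuous_toFun
  have hφc := hφ.1
  have hψc := hψ.1
  have ca := hφ.1.norm
  have cb := hψ.1.norm
  have sa := hφ.2.norm
  have sb := hψ.2.norm
  have ia : Integrable (fun y => ω y * ‖φ y‖) μ :=
    (hω.mul ca).integrable_of_hasCompactSupport sa.mul_left
  have ib : Integrable (fun y => ω y * ‖ψ y‖) μ :=
    (hω.mul cb).integrable_of_hasCompactSupport sb.mul_left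
  obtain ⟨c1, c2⟩ := convolution_compact (μ := μ) ca sa cb sb
  have e1 : ∫⁻ x, ∫⁻ y, ‖φ y * ψ (y⁻¹ * x)‖ₑ ∂μ ∂(weightedMeasure μ ω) =
      ENNReal.ofReal (∫ x, ω x * ∫ y, ‖φ y‖ * ‖ψ (y⁻¹ * x)‖ ∂μ ∂μ) := by
    rw [lintegral_weighted, ofReal_integral_eq_lintegral_ofReal]
    · refine lintegral_congr fun x => ?_
      rw [ENNReal.ofReal_mul (weight_pos ω x).le,
        ← ofReal_integral_norm_eq_lintegral_enorm (hφ.kernel hψ x).integrable]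
      simp only [norm_mul]
    · exact (hω.mul c1).integrable_of_hasCompactSupport c2.mul_left
    · exact Eventually.of_forall fun x => mul_nonneg (weight_pos ω x).le
        (integral_nonneg fun y => by positivity)
  rw [e1, hφ.lintegral_eq, hψ.lintegral_eq,
    ← ENNReal.ofReal_mul (integral_nonneg fun x => mul_nonneg (weight_pos ω x).le (norm_nonneg _))]
  refine ENNReal.ofReal_le_ofReal ?_
  calc ∫ x, ω x * ∫ y, ‖φ y‖ * ‖ψ (y⁻¹ * x)‖ ∂μ ∂μ
      = ∫ x, ∫ y, ‖φ y‖ * ‖ψ (y⁻¹ * x)‖ * ω x ∂μ ∂μ := by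
        refine integral_congr_ae (Eventually.of_forall fun x => ?_)
        simp only [integral_mul_const, mul_comm]
    _ = ∫ y, ∫ x, ‖φ y‖ * ‖ψ (y⁻¹ * x)‖ * ω x ∂μ ∂μ := by
        symm
        refine integral_integral_swap_of_hasCompactSupport ?_ ?_
        · simp only [Function.uncurry_def]
          fun_prop
        · exact (kernel_compact sa sb).mul_right
    _ = ∫ y, ‖φ y‖ * ∫ x, ω (y * x) * ‖ψ x‖ ∂μ ∂μ := by
        refine integral_congr_ae (Eventually.of_forall fun y => ?_)
        simp only [mul_assoc]
        rw [integral_const_mul, ← integral_mul_left_eq_self _ y]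
        simp [mul_comm]
    _ ≤ ∫ y, (ω y * ‖φ y‖) * ∫ x, ω x * ‖ψ x‖ ∂μ ∂μ := by
        have h : ∀ y, ∫ x, ω (y * x) * ‖ψ x‖ ∂μ ≤ ω y * ∫ x, ω x * ‖ψ x‖ ∂μ := by
          intro y
          rw [← integral_const_mul]
          refine integral_mono ?_ (ib.const_mul _) fun x => ?_
          · exact ((hω.comp (continuous_const_mul y)).mul cb).integrable_of_hasCompactSupport
              sb.mul_left
          · simp only [← mul_assoc]
            exact mul_le_mul_of_nonneg_right (ω.map_mul_le y x) (norm_nonneg _)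
        refine integral_mono_of_nonneg (Eventually.of_forall fun y => ?_) (ia.mul_const _)
          (Eventually.of_forall fun y => ?_)
        · exact mul_nonneg (norm_nonneg _) (integral_nonneg fun x =>
            mul_nonneg (weight_pos ω _).le (norm_nonneg _))
        · calc ‖φ y‖ * ∫ x, ω (y * x) * ‖ψ x‖ ∂μ
              ≤ ‖φ y‖ * (ω y * ∫ x, ω x * ‖ψ x‖ ∂μ) :=
                mul_le_mul_of_nonneg_left (h y) (norm_nonneg _)
            _ = _ := by ring
    _ = _ := integral_mul_const _ _

theorem IsCc.convolution_assoc {φ ψ χ : G → ℂ} (hφ : IsCc φ) (hψ : IsCc ψ) (hχ : IsCc χ) :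
    groupConvolution μ (groupConvolution μ φ ψ) χ =
      groupConvolution μ φ (groupConvolution μ ψ χ) := by
  funext x
  have := hφ.1
  have := hψ.1
  have := hχ.1
  simp only [groupConvolution]
  calc ∫ z, (∫ y, φ y * ψ (y⁻¹ * z) ∂μ) * χ (z⁻¹ * x) ∂μ
      = ∫ z, ∫ y, φ y * ψ (y⁻¹ * z) * χ (z⁻¹ * x) ∂μ ∂μ := by simp only [integral_mul_const]
    _ = ∫ y, ∫ z, φ y * ψ (y⁻¹ * z) * χ (z⁻¹ * x) ∂μ ∂μ := by
        symm
        refine integral_integral_swap_of_hasCompactSupport ?_ ?_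
        · simp only [Function.uncurry_def]
          fun_prop
        · exact (kernel_compact hφ.2 hψ.2).mul_right
    _ = _ := by
        refine integral_congr_ae (Eventually.of_forall fun y => ?_)
        simp only [mul_assoc]
        rw [integral_const_mul, ← integral_mul_left_eq_self _ y]
        simp [mul_assoc]

end CompactSupport
section Young

variable [μ.IsHaarMeasure] [μ.Regular]

theorem lintegral_kernel_measurable {φ ψ : G → ℂ} (hφ : IsCc φ) (hψ : IsCc ψ) :
    Measurable fun x => ∫⁻ y, ‖φ y * ψ (y⁻¹ * x)‖ₑ ∂μ := by
  have h : (fun x => ∫⁻ y, ‖φ y * ψ (y⁻¹ * x)‖ₑ ∂μ) =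
      fun x => ENNReal.ofReal (∫ y, ‖φ y‖ * ‖ψ (y⁻¹ * x)‖ ∂μ) := by
    funext x
    rw [← ofReal_integral_norm_eq_lintegral_enorm (hφ.kernel hψ x).integrable]
    simp only [norm_mul]
  rw [h]
  exact (convolution_compact (μ := μ) hφ.1.norm hφ.2.norm hψ.1.norm
    hψ.2.norm).1.measurable.ennreal_ofReal

theorem ae_eq_zero_of_series {f : G → ℂ} {φ : ℕ → G → ℂ}
    (h : ∀ᵐ x ∂μ, HasSum (fun n => φ n x) (f x)) :
    ∀ᵐ x ∂μ, x ∉ ⋃ n, tsupport (φ n) → f x = 0 := by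
  filter_upwards [h] with x hx hmem
  have : (fun n => φ n x) = fun _ => 0 := by
    funext n
    exact image_eq_zero_of_notMem_tsupport fun hn => hmem (mem_iUnion.2 ⟨n, hn⟩)
  rw [this] at hx
  exact hx.unique hasSum_zero

/-- Convolutions of integrable functions: almost everywhere absolute convergence of the integral,
integrability and norm estimate. -/
theorem young_aux {f g : G → ℂ} (hf : Integrable f (weightedMeasure μ ω))
    (hg : Integrable g (weightedMeasure μ ω)) {ε : ℝ≥0∞} (hε : ε ≠ 0) (hε' : ε ≠ ∞) :
    (∀ᵐ x ∂μ, Integrable (fun y => f y * g (y⁻¹ * x)) μ) ∧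
      Integrable (groupConvolution μ f g) (weightedMeasure μ ω) ∧
      ∫⁻ x, ‖groupConvolution μ f g x‖ₑ ∂(weightedMeasure μ ω) ≤
        (∫⁻ x, ‖f x‖ₑ ∂(weightedMeasure μ ω) + ε) * (∫⁻ x, ‖g x‖ₑ ∂(weightedMeasure μ ω) + ε) := by
  set ν := weightedMeasure μ ω with hν
  obtain ⟨φ, hφ, hφs, hφf⟩ := exists_series hf hε hε'
  obtain ⟨ψ, hψ, hψs, hψg⟩ := exists_series hg hε hε'
  have htot : ∑' p : ℕ × ℕ, ∫⁻ x, ∫⁻ y, ‖φ p.1 y * ψ p.2 (y⁻¹ * x)‖ₑ ∂μ ∂ν ≤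
      (∫⁻ x, ‖f x‖ₑ ∂ν + ε) * (∫⁻ x, ‖g x‖ₑ ∂ν + ε) := by
    calc _ ≤ ∑' p : ℕ × ℕ, (∫⁻ x, ‖φ p.1 x‖ₑ ∂ν) * ∫⁻ x, ‖ψ p.2 x‖ₑ ∂ν :=
          ENNReal.tsum_le_tsum fun p => (hφ p.1).lintegral_kernel_le (hψ p.2)
      _ = (∑' n, ∫⁻ x, ‖φ n x‖ₑ ∂ν) * ∑' n, ∫⁻ x, ‖ψ n x‖ₑ ∂ν := by
          rw [ENNReal.tsum_prod (f := fun n m => (∫⁻ x, ‖φ n x‖ₑ ∂ν) * ∫⁻ x, ‖ψ m x‖ₑ ∂ν)]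
          simp only [ENNReal.tsum_mul_left, ENNReal.tsum_mul_right]
      _ ≤ _ := by gcongr
  have hfin : (∫⁻ x, ‖f x‖ₑ ∂ν + ε) * (∫⁻ x, ‖g x‖ₑ ∂ν + ε) ≠ ∞ :=
    ENNReal.mul_ne_top (ENNReal.add_ne_top.2 ⟨hf.2.ne, hε'⟩) (ENNReal.add_ne_top.2 ⟨hg.2.ne, hε'⟩)
  have hmeas : ∀ p : ℕ × ℕ, AEMeasurable (fun x => ∫⁻ y, ‖φ p.1 y * ψ p.2 (y⁻¹ * x)‖ₑ ∂μ) ν :=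
    fun p => (lintegral_kernel_measurable (hφ p.1) (hψ p.2)).aemeasurable
  have hae : ∀ᵐ x ∂μ, ∑' p : ℕ × ℕ, ∫⁻ y, ‖φ p.1 y * ψ p.2 (y⁻¹ * x)‖ₑ ∂μ < ∞ := by
    rw [← ae_weighted μ ω]
    refine ae_lt_top' (AEMeasurable.tsum hmeas) ?_
    rw [lintegral_tsum hmeas]
    exact ne_top_of_le_ne_top hfin htot
  have hpt : ∀ x, ∀ᵐ y ∂μ,
      HasSum (fun p : ℕ × ℕ => φ p.1 y * ψ p.2 (y⁻¹ * x)) (f y * g (y⁻¹ * x)) := by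
    intro x
    filter_upwards [hφf, ae_eq_zero_of_series (hφf.mono fun _ h => h.2),
      ae_translate hψg (K := fun n => tsupport (φ n)) (fun n => (hφ n).2) x] with y h1 h2 h3
    by_cases hy : y ∈ ⋃ n, tsupport (φ n)
    · obtain ⟨h4, h5⟩ := h3 hy
      exact HasSum.mul (f := fun n => φ n y) (g := fun m => ψ m (y⁻¹ * x)) h1.2 h5
        (summable_mul_of_summable_norm (f := fun n => φ n y) (g := fun m => ψ m (y⁻¹ * x))
          h1.1 h4)
    · have hz : ∀ n, φ n y = 0 := fun n =>
        image_eq_zero_of_notMem_tsupport fun hn => hy (mem_iUnion.2 ⟨n, hn⟩)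
      simp only [hz, zero_mul, h2 hy]
      exact hasSum_zero
  have hser := fun x (hx : ∑' p : ℕ × ℕ, ∫⁻ y, ‖φ p.1 y * ψ p.2 (y⁻¹ * x)‖ₑ ∂μ < ∞) =>
    series_lemma (k := fun p y => φ p.1 y * ψ p.2 (y⁻¹ * x))
      (fun p => ((hφ p.1).kernel (hψ p.2) x).integrable) hx.ne (hpt x)
  have hle : ∑' p : ℕ × ℕ, ∫⁻ x, ‖groupConvolution μ (φ p.1) (ψ p.2) x‖ₑ ∂ν ≤
      (∫⁻ x, ‖f x‖ₑ ∂ν + ε) * (∫⁻ x, ‖g x‖ₑ ∂ν + ε) :=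
    (ENNReal.tsum_le_tsum fun p => lintegral_mono fun _ =>
      enorm_integral_le_lintegral_enorm _).trans htot
  have hout := series_lemma (ρ := ν) (h := groupConvolution μ f g)
    (k := fun p => groupConvolution μ (φ p.1) (ψ p.2))
    (fun p => ((hφ p.1).convolution (hψ p.2)).weighted_integrable)
    (ne_top_of_le_ne_top hfin hle) (by
      rw [hν, ae_weighted]
      filter_upwards [hae] with x hx using (hser x hx).2.1)
  refine ⟨?_, hout.1, hout.2.2.trans hle⟩
  filter_upwards [hae] with x hx using (hser x hx).1

theorem ae_integrable_kernel {f g : G → ℂ} (hf : Integrable f (weightedMeasure μ ω))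
    (hg : Integrable g (weightedMeasure μ ω)) :
    ∀ᵐ x ∂μ, Integrable (fun y => f y * g (y⁻¹ * x)) μ :=
  (young_aux hf hg one_ne_zero ENNReal.one_ne_top).1

theorem integrable_convolution {f g : G → ℂ} (hf : Integrable f (weightedMeasure μ ω))
    (hg : Integrable g (weightedMeasure μ ω)) :
    Integrable (groupConvolution μ f g) (weightedMeasure μ ω) :=
  (young_aux hf hg one_ne_zero ENNReal.one_ne_top).2.1

theorem lintegral_convolution_le {f g : G → ℂ} (hf : Integrable f (weightedMeasure μ ω))
    (hg : Integrable g (weightedMeasure μ ω)) :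
    ∫⁻ x, ‖groupConvolution μ f g x‖ₑ ∂(weightedMeasure μ ω) ≤
      (∫⁻ x, ‖f x‖ₑ ∂(weightedMeasure μ ω)) * ∫⁻ x, ‖g x‖ₑ ∂(weightedMeasure μ ω) := by
  set a := ∫⁻ x, ‖f x‖ₑ ∂(weightedMeasure μ ω) with ha
  set b := ∫⁻ x, ‖g x‖ₑ ∂(weightedMeasure μ ω) with hb
  have ha' : a ≠ ∞ := hf.2.ne
  have hb' : b ≠ ∞ := hg.2.ne
  have ht : Tendsto (fun ε : ℝ≥0∞ => (a + ε) * (b + ε)) (𝓝[>] 0) (𝓝 ((a + 0) * (b + 0))) := by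
    refine Tendsto.mono_left ?_ nhdsWithin_le_nhds
    refine ENNReal.Tendsto.mul (tendsto_const_nhds.add tendsto_id) (Or.inr (by simpa))
      (tendsto_const_nhds.add tendsto_id) (Or.inr (by simpa))
  rw [add_zero, add_zero] at ht
  refine ge_of_tendsto ht ?_
  have h1 : ∀ᶠ ε : ℝ≥0∞ in 𝓝[>] 0, ε < 1 := nhdsWithin_le_nhds (gt_mem_nhds one_pos)
  filter_upwards [h1, self_mem_nhdsWithin] with ε h1 h2
  exact (young_aux hf hg (ne_of_gt h2) (h1.trans_le le_top).ne).2.2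

theorem convolution_congr_left {f f' : G → ℂ} (h : f =ᵐ[μ] f') (g : G → ℂ) :
    groupConvolution μ f g = groupConvolution μ f' g := by
  funext x
  refine integral_congr_ae ?_
  filter_upwards [h] with y hy
  rw [hy]

theorem convolution_congr_right {f : G → ℂ} (hf : Integrable f (weightedMeasure μ ω))
    {g g' : G → ℂ} (h : g =ᵐ[μ] g') : groupConvolution μ f g = groupConvolution μ f g' := by
  obtain ⟨φ, hφ, -, hφf⟩ := exists_series hf one_ne_zero ENNReal.one_ne_top
  funext x
  refine integral_congr_ae ?_
  filter_upwards [ae_eq_zero_of_series (hφf.mono fun _ h => h.2),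
      ae_translate h (K := fun n => tsupport (φ n)) (fun n => (hφ n).2) x] with y h2 h3
  by_cases hy : y ∈ ⋃ n, tsupport (φ n)
  · rw [h3 hy]
  · rw [h2 hy, zero_mul, zero_mul]

end Young

end BeurlingAux

/-- The Beurling algebra `L¹(G, ω)`: (classes of) measurable functions `f` such that `ω f` is
integrable with respect to the Haar measure `μ`, with the norm `∫ |f| ω dμ`. -/
def BeurlingAlgebra (μ : Measure G) (ω : WeightFunction G) : Type _ :=
  Lp ℂ 1 (weightedMeasure μ ω)

namespace BeurlingAlgebra

open BeurlingAux

variable (μ : Measure G) (ω : WeightFunction G)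

noncomputable instance : NormedAddCommGroup (BeurlingAlgebra μ ω) :=
  inferInstanceAs (NormedAddCommGroup (Lp ℂ 1 (weightedMeasure μ ω)))

noncomputable instance : NormedSpace ℂ (BeurlingAlgebra μ ω) :=
  inferInstanceAs (NormedSpace ℂ (Lp ℂ 1 (weightedMeasure μ ω)))

instance : CompleteSpace (BeurlingAlgebra μ ω) :=
  inferInstanceAs (CompleteSpace (Lp ℂ 1 (weightedMeasure μ ω)))

variable {μ ω}

/-- An element of the Beurling algebra as an element of Mathlib's space `L¹(ω μ)`. -/
def toLp (f : BeurlingAlgebra μ ω) : Lp ℂ 1 (weightedMeasure μ ω) := f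

/-- A representative of an element of the Beurling algebra. -/
noncomputable def rep (f : BeurlingAlgebra μ ω) : G → ℂ := f.toLp

/-- The class of a function that is integrable with respect to `ω(x) dμ(x)`. -/
noncomputable def ofIntegrable (f : G → ℂ) (hf : Integrable f (weightedMeasure μ ω)) :
    BeurlingAlgebra μ ω :=
  hf.toL1 f

theorem integrable_rep (f : BeurlingAlgebra μ ω) : Integrable f.rep (weightedMeasure μ ω) :=
  L1.integrable_coeFn f.toLp

theorem ofIntegrable_rep (f : BeurlingAlgebra μ ω) : ofIntegrable f.rep f.integrable_rep = f :=
  Integrable.toL1_coeFn f.toLp f.integrable_rep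

variable [BorelSpace G]

theorem rep_ofIntegrable {f : G → ℂ} (hf : Integrable f (weightedMeasure μ ω)) :
    (ofIntegrable f hf).rep =ᵐ[μ] f :=
  (ac_weighted μ ω).ae_eq hf.coeFn_toL1

theorem rep_add (f g : BeurlingAlgebra μ ω) : (f + g).rep =ᵐ[μ] f.rep + g.rep :=
  (ac_weighted μ ω).ae_eq (Lp.coeFn_add f.toLp g.toLp)

theorem rep_smul (c : ℂ) (f : BeurlingAlgebra μ ω) : (c • f).rep =ᵐ[μ] c • f.rep :=
  (ac_weighted μ ω).ae_eq (Lp.coeFn_smul c f.toLp)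

theorem ext_rep {f g : BeurlingAlgebra μ ω} (h : f.rep =ᵐ[μ] g.rep) : f = g :=
  Lp.ext (f := f.toLp) (g := g.toLp) ((weighted_ac μ ω).ae_eq h)

theorem enorm_eq (f : BeurlingAlgebra μ ω) : ‖f‖ₑ = ∫⁻ x, ‖f.rep x‖ₑ ∂(weightedMeasure μ ω) := by
  conv_lhs => rw [← ofIntegrable_rep f]
  exact Integrable.enorm_toL1 f.integrable_rep

theorem enorm_ofIntegrable {f : G → ℂ} (hf : Integrable f (weightedMeasure μ ω)) :
    ‖ofIntegrable f hf‖ₑ = ∫⁻ x, ‖f x‖ₑ ∂(weightedMeasure μ ω) :=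
  hf.enorm_toL1

/-- The norm is `‖f‖ = ∫ ω |f| dμ`. -/
theorem norm_eq (f : BeurlingAlgebra μ ω) : ‖f‖ = ∫ x, ω x * ‖f.rep x‖ ∂μ := by
  have h : Integrable (fun x => ω x • f.rep x) μ :=
    (integrable_weighted_iff μ ω).1 f.integrable_rep
  rw [← toReal_enorm, enorm_eq, lintegral_weighted]
  simp only [← enorm_weight_smul]
  rw [← integral_norm_eq_lintegral_enorm h.1]
  refine integral_congr_ae (Filter.Eventually.of_forall fun x => ?_)
  simp only [norm_smul, Real.norm_of_nonneg (weight_pos ω x).le]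

variable [IsTopologicalGroup G] [LocallyCompactSpace G] [μ.IsHaarMeasure] [μ.Regular]

/-- The product of the Beurling algebra is the convolution. -/
noncomputable instance : Mul (BeurlingAlgebra μ ω) :=
  ⟨fun f g => ofIntegrable (groupConvolution μ f.rep g.rep)
    (integrable_convolution f.integrable_rep g.integrable_rep)⟩

theorem mul_def (f g : BeurlingAlgebra μ ω) :
    f * g = ofIntegrable (groupConvolution μ f.rep g.rep)
      (integrable_convolution f.integrable_rep g.integrable_rep) := rfl

theorem rep_mul (f g : BeurlingAlgebra μ ω) : (f * g).rep =ᵐ[μ] groupConvolution μ f.rep g.rep :=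
  rep_ofIntegrable _

theorem left_distrib_aux (f g h : BeurlingAlgebra μ ω) : f * (g + h) = f * g + f * h := by
  refine ext_rep ?_
  filter_upwards [rep_mul f (g + h), rep_mul f g, rep_mul f h, rep_add (f * g) (f * h),
    ae_integrable_kernel f.integrable_rep g.integrable_rep,
    ae_integrable_kernel f.integrable_rep h.integrable_rep] with x h1 h2 h3 h4 h5 h6
  rw [h1, h4, Pi.add_apply, h2, h3, convolution_congr_right f.integrable_rep (rep_add g h)]
  simp only [groupConvolution, Pi.add_apply, mul_add]
  exact integral_add h5 h6

theorem right_distrib_aux (f g h : BeurlingAlgebra μ ω) : (f + g) * h = f * h + g * h := by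
  refine ext_rep ?_
  filter_upwards [rep_mul (f + g) h, rep_mul f h, rep_mul g h, rep_add (f * h) (g * h),
    ae_integrable_kernel f.integrable_rep h.integrable_rep,
    ae_integrable_kernel g.integrable_rep h.integrable_rep] with x h1 h2 h3 h4 h5 h6
  rw [h1, h4, Pi.add_apply, h2, h3, convolution_congr_left (rep_add f g)]
  simp only [groupConvolution, Pi.add_apply, add_mul]
  exact integral_add h5 h6

theorem smul_mul_aux (c : ℂ) (f g : BeurlingAlgebra μ ω) : (c • f) * g = c • (f * g) := by
  refine ext_rep ?_
  filter_upwards [rep_mul (c • f) g, rep_mul f g, rep_smul c (f * g)] with x h1 h2 h3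
  rw [h1, h3, Pi.smul_apply, h2, convolution_congr_left (rep_smul c f)]
  simp only [groupConvolution, Pi.smul_apply, smul_mul_assoc]
  exact integral_smul _ _

theorem mul_smul_aux (c : ℂ) (f g : BeurlingAlgebra μ ω) : f * (c • g) = c • (f * g) := by
  refine ext_rep ?_
  filter_upwards [rep_mul f (c • g), rep_mul f g, rep_smul c (f * g)] with x h1 h2 h3
  rw [h1, h3, Pi.smul_apply, h2, convolution_congr_right f.integrable_rep (rep_smul c g)]
  simp only [groupConvolution, Pi.smul_apply, mul_smul_comm]
  exact integral_smul _ _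

theorem norm_mul_le_aux (f g : BeurlingAlgebra μ ω) : ‖f * g‖ ≤ ‖f‖ * ‖g‖ := by
  have h : ‖f * g‖ₑ ≤ ‖f‖ₑ * ‖g‖ₑ := by
    rw [mul_def, enorm_ofIntegrable, enorm_eq f, enorm_eq g]
    exact lintegral_convolution_le f.integrable_rep g.integrable_rep
  have := ENNReal.toReal_mono (ENNReal.mul_ne_top enorm_ne_top enorm_ne_top) h
  simpa using this

/-- The product as a bounded bilinear map. -/
noncomputable def mulBilinear :
    BeurlingAlgebra μ ω →L[ℂ] BeurlingAlgebra μ ω →L[ℂ] BeurlingAlgebra μ ω :=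
  LinearMap.mkContinuous₂ (LinearMap.mk₂ ℂ (fun f g => f * g) right_distrib_aux smul_mul_aux
    left_distrib_aux mul_smul_aux) 1 fun f g => by simpa using norm_mul_le_aux f g

theorem continuous_mul_aux {X : Type*} [TopologicalSpace X] {u v : X → BeurlingAlgebra μ ω}
    (hu : Continuous u) (hv : Continuous v) : Continuous fun x => u x * v x :=
  (mulBilinear (μ := μ) (ω := ω)).continuous₂.comp (hu.prodMk hv)

@[elab_as_elim]
theorem induction_on {p : BeurlingAlgebra μ ω → Prop} (f : BeurlingAlgebra μ ω)
    (hp : IsClosed {f | p f})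
    (h : ∀ (φ : G → ℂ) (hφ : IsCc φ), p (ofIntegrable φ hφ.weighted_integrable)) : p f := by
  have hd : Dense {f : BeurlingAlgebra μ ω | ∃ (φ : G → ℂ) (hφ : IsCc φ),
      f = ofIntegrable φ hφ.weighted_integrable} := by
    intro f
    rw [EMetric.mem_closure_iff]
    intro ε hε
    have hδ : min ε 1 ≠ 0 := (lt_min hε one_pos).ne'
    have hδ' : min ε 1 ≠ ∞ := ne_top_of_le_ne_top ENNReal.one_ne_top (min_le_right _ _)
    obtain ⟨φ, hφ, hle⟩ := exists_approx f.integrable_rep (ENNReal.half_pos hδ).ne'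
    refine ⟨_, ⟨φ, hφ, rfl⟩, ?_⟩
    have e : edist f (ofIntegrable φ hφ.weighted_integrable) =
        ∫⁻ x, ‖f.rep x - φ x‖ₑ ∂(weightedMeasure μ ω) := by
      conv_lhs => rw [← ofIntegrable_rep f]
      rw [edist_eq_enorm_sub]
      have : ofIntegrable f.rep f.integrable_rep - ofIntegrable φ hφ.weighted_integrable =
          ofIntegrable (f.rep - φ) (f.integrable_rep.sub (hφ.weighted_integrable (ω := ω))) :=
        (Integrable.toL1_sub f.rep φ f.integrable_rep hφ.weighted_integrable).symm
      rw [this, enorm_ofIntegrable]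
      rfl
    rw [e]
    exact (hle.trans_lt (ENNReal.half_lt_self hδ hδ')).trans_le (min_le_left _ _)
  refine hp.closure_subset_iff.2 ?_ (hd f)
  rintro _ ⟨φ, hφ, rfl⟩
  exact h φ hφ

theorem ofIntegrable_mul {φ ψ : G → ℂ} (hφ : IsCc φ) (hψ : IsCc ψ) :
    ofIntegrable (ω := ω) φ (hφ.weighted_integrable (μ := μ)) *
        ofIntegrable ψ hψ.weighted_integrable =
      ofIntegrable (groupConvolution μ φ ψ) (hφ.convolution hψ).weighted_integrable := by
  refine ext_rep ?_
  filter_upwards [rep_mul (ofIntegrable (ω := ω) φ (hφ.weighted_integrable (μ := μ)))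
    (ofIntegrable ψ hψ.weighted_integrable), rep_ofIntegrable (ω := ω)
      (hφ.convolution (μ := μ) hψ).weighted_integrable] with x h1 h2
  rw [h1, h2, convolution_congr_left (rep_ofIntegrable _),
    convolution_congr_right (ω := ω) hφ.weighted_integrable (rep_ofIntegrable _)]

theorem mul_assoc_aux (f g h : BeurlingAlgebra μ ω) : f * g * h = f * (g * h) := by
  refine induction_on f (isClosed_eq ?_ ?_) fun φ hφ => ?_
  · exact continuous_mul_aux (continuous_mul_aux continuous_id continuous_const) continuous_const
  · exact continuous_mul_aux continuous_id continuous_const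
  refine induction_on g (isClosed_eq ?_ ?_) fun ψ hψ => ?_
  · exact continuous_mul_aux (continuous_mul_aux continuous_const continuous_id) continuous_const
  · exact continuous_mul_aux continuous_const (continuous_mul_aux continuous_id continuous_const)
  refine induction_on h (isClosed_eq ?_ ?_) fun χ hχ => ?_
  · exact continuous_mul_aux continuous_const continuous_id
  · exact continuous_mul_aux continuous_const (continuous_mul_aux continuous_const continuous_id)
  rw [ofIntegrable_mul hφ hψ, ofIntegrable_mul hψ hχ, ofIntegrable_mul (hφ.convolution hψ) hχ,
    ofIntegrable_mul hφ (hψ.convolution hχ)]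
  congr 1
  exact hφ.convolution_assoc hψ hχ

theorem zero_mul_aux (f : BeurlingAlgebra μ ω) : 0 * f = 0 := by
  have h := right_distrib_aux 0 0 f
  rw [add_zero] at h
  exact left_eq_add.mp h

theorem mul_zero_aux (f : BeurlingAlgebra μ ω) : f * 0 = 0 := by
  have h := left_distrib_aux f 0 0
  rw [add_zero] at h
  exact left_eq_add.mp h

noncomputable instance : NonUnitalNormedRing (BeurlingAlgebra μ ω) where
  __ := (inferInstance : NormedAddCommGroup (BeurlingAlgebra μ ω))
  __ := (inferInstance : Mul (BeurlingAlgebra μ ω))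
  left_distrib := left_distrib_aux
  right_distrib := right_distrib_aux
  zero_mul := zero_mul_aux
  mul_zero := mul_zero_aux
  mul_assoc := mul_assoc_aux
  norm_mul_le := norm_mul_le_aux

instance : IsScalarTower ℂ (BeurlingAlgebra μ ω) (BeurlingAlgebra μ ω) where
  smul_assoc := smul_mul_aux

instance : SMulCommClass ℂ (BeurlingAlgebra μ ω) (BeurlingAlgebra μ ω) where
  smul_comm c f g := (mul_smul_aux c f g).symm

end BeurlingAlgebra

end Beurling

/-! ### Derivations into the dual, and descent of weak amenability along a character. -/

section InnerDerivations

/-! Write `A` and `B` for the two Beurling algebras and `P` for their projective tensor product.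
Since the weight on the second group is at least `1`, integration against Haar measure is a bounded
character `φ` of `B`, and `π = id ⊗ φ` is a bounded homomorphism from `P` to `A`. A bounded
derivation `D : A → A*` therefore pulls back to the derivation `π* ∘ D ∘ π` on `P`, which is inner
by hypothesis, say implemented by `z`.

To return to `A`, fix `b₀` in `B` with `φ b₀ = 1` and evaluate at `a ⊗ e` and `x ⊗ b₀`. The outcome
is `φ(e b₀) D(a)(x) = z(ax ⊗ e b₀) - z(xa ⊗ b₀ e)`. If `e` runs through elements with `e b₀ → b₀`
and `b₀ e → b₀`, the limit is `D(a)(x) = z(ax ⊗ b₀) - z(xa ⊗ b₀)`, so `D` is inner, implemented by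
`z(· ⊗ b₀)`. Only units for the single element `b₀` are needed, and no bound on their norms. This is
`IsWeaklyAmenable.of_character`.

Its inputs come from two sources. The universal property of the projective tensor product
(`lift_tmul`, `lift_mul`) supplies `π`. On the Beurling side, `augmentation_mul` shows that `φ` is
multiplicative, and `exists_augmentation_eq_one` takes for `b₀` a continuous compactly supported
function of integral one, with narrow symmetric bumps as units. The other factor is handled with the
roles exchanged. -/

/-- The derivation into the dual of `P` induced by a derivation into the dual of `A` and a linear
map from `P` to `A`. -/
noncomputable def pullbackDualDerivation {A P : Type*} [NonUnitalNormedRing A] [NormedSpace ℂ A]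
    [NonUnitalNormedRing P] [NormedSpace ℂ P] (D : A →L[ℂ] StrongDual ℂ A) (π : P →L[ℂ] A) :
    P →L[ℂ] StrongDual ℂ P :=
  ((ContinuousLinearMap.compL ℂ P A ℂ).flip π).comp (D.comp π)

theorem pullbackDualDerivation_apply {A P : Type*} [NonUnitalNormedRing A] [NormedSpace ℂ A]
    [NonUnitalNormedRing P] [NormedSpace ℂ P] (D : A →L[ℂ] StrongDual ℂ A) (π : P →L[ℂ] A) (p q : P) :
    pullbackDualDerivation D π p q = D (π p) (π q) := rfl

variable {A : Type*} [NonUnitalNormedRing A] [NormedSpace ℂ A] [IsScalarTower ℂ A A]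
  [SMulCommClass ℂ A A]

theorem dualLeftAction_apply (a : A) (z : StrongDual ℂ A) (x : A) :
    dualLeftAction a z x = z (x * a) := rfl

theorem dualRightAction_apply (z : StrongDual ℂ A) (a x : A) :
    dualRightAction z a x = z (a * x) := rfl

/-- The identity telescopes: `z(abx) - z(xab)` is the sum of `z(abx) - z(bxa)` and `z(bxa) -
z(xab)`. -/
theorem IsInnerDualDerivation.isDualDerivation {D : A →L[ℂ] StrongDual ℂ A}
    (hD : IsInnerDualDerivation D) : IsDualDerivation D := by
  obtain ⟨z, hz⟩ := hD
  intro a b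
  ext x
  simp only [hz, add_apply, sub_apply,
    dualLeftAction_apply, dualRightAction_apply, mul_assoc]
  ring

/-- The definition asks for an equality of sets; inner maps are always derivations, so only one
inclusion has content. -/
theorem isWeaklyAmenable_iff [CompleteSpace A] : IsWeaklyAmenable A ↔
    ∀ D : A →L[ℂ] StrongDual ℂ A, IsDualDerivation D → IsInnerDualDerivation D :=
  ⟨fun h D hD => (Set.ext_iff.1 h D).1 hD,
    fun h => Set.Subset.antisymm h fun _ hD => hD.isDualDerivation⟩

variable {P : Type*} [NonUnitalNormedRing P] [NormedSpace ℂ P] [IsScalarTower ℂ P P]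
  [SMulCommClass ℂ P P]

/-- Through the homomorphism `π`, the dual of `A` becomes a `P`-bimodule, and the adjoint of `π`
respects the two bimodule structures. -/
theorem IsDualDerivation.pullback {D : A →L[ℂ] StrongDual ℂ A} (hD : IsDualDerivation D)
    {π : P →L[ℂ] A} (hπ : ∀ p q, π (p * q) = π p * π q) :
    IsDualDerivation (pullbackDualDerivation D π) := by
  intro p q
  ext x
  simp only [add_apply, dualLeftAction_apply, dualRightAction_apply,
    pullbackDualDerivation_apply, hπ, hD (π p) (π q)]

variable {B : Type*} [NonUnitalNormedRing B] [NormedSpace ℂ B]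

/-- Weak amenability of a product `P` of `A` and `B` passes to `A` if `B` has a character and
contains an element outside its kernel for which there are approximate units. -/
theorem IsWeaklyAmenable.of_character [CompleteSpace A] [CompleteSpace P] (hP : IsWeaklyAmenable P)
    (T : A →L[ℂ] B →L[ℂ] P) (hT : ∀ a b a' b', T a b * T a' b' = T (a * a') (b * b'))
    (φ : B →L[ℂ] ℂ) (hφ : ∀ b b', φ (b * b') = φ b * φ b')
    (π : P →L[ℂ] A) (hπ : ∀ p q, π (p * q) = π p * π q) (hπT : ∀ a b, π (T a b) = φ b • a)
    (b₀ : B) (hb₀ : φ b₀ = 1)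
    (he : ∀ ε : ℝ, 0 < ε → ∃ e : B, ‖e * b₀ - b₀‖ ≤ ε ∧ ‖b₀ * e - b₀‖ ≤ ε) :
    IsWeaklyAmenable A := by
  rw [isWeaklyAmenable_iff] at hP ⊢
  intro D hD
  obtain ⟨z, hz⟩ := hP _ (hD.pullback hπ)
  choose e he₁ he₂ using fun n : ℕ => he (1 / (n + 1)) Nat.one_div_pos_of_nat
  have l₁ : Filter.Tendsto (fun n => e n * b₀) Filter.atTop (nhds b₀) :=
    tendsto_iff_norm_sub_tendsto_zero.2 (squeeze_zero (fun _ => norm_nonneg _) he₁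
      tendsto_one_div_add_atTop_nhds_zero_nat)
  have l₂ : Filter.Tendsto (fun n => b₀ * e n) Filter.atTop (nhds b₀) :=
    tendsto_iff_norm_sub_tendsto_zero.2 (squeeze_zero (fun _ => norm_nonneg _) he₂
      tendsto_one_div_add_atTop_nhds_zero_nat)
  -- The implementing functional is `x ↦ z (T x b₀)`, the slice of `z` at `b₀`.
  refine ⟨z.comp (T.flip b₀), fun a => ?_⟩
  ext x
  -- The scalar `φ (e n)` is written as `φ (e n * b₀)`, which is legitimate because `φ b₀ = 1`. In
  -- this form every term depends on `e n` only through products with `b₀`, whose limits are known;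
  -- `e n` itself need not converge.
  have key : ∀ n, φ (e n * b₀) * D a x = z (T (a * x) (e n * b₀)) - z (T (x * a) (b₀ * e n)) := by
    intro n
    have := congrArg (fun w : StrongDual ℂ P => w (T x b₀)) (hz (T a (e n)))
    simp only [sub_apply, dualLeftAction_apply, dualRightAction_apply,
      pullbackDualDerivation_apply, hT, hπT, map_smul, smul_apply,
      smul_eq_mul, hb₀, one_mul] at this
    rw [hφ, hb₀, mul_one, this]
  have c₁ := (((φ.continuous.tendsto _).comp l₁).mul_const (D a x))
  have c₂ := (((z.comp (T (a * x))).continuous.tendsto _).comp l₁).sub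
    (((z.comp (T (x * a))).continuous.tendsto _).comp l₂)
  have := tendsto_nhds_unique (c₁.congr key) c₂
  rw [hb₀, one_mul] at this
  exact this

end InnerDerivations

/-! ### The universal property of the projective tensor product. -/

namespace ProjectiveTensorProduct

open TensorProduct

variable {A B C : Type*} [NonUnitalNormedRing A] [NormedSpace ℂ A]
  [NonUnitalNormedRing B] [NormedSpace ℂ B]

/-- The canonical bilinear map into the projective tensor product. -/
noncomputable def tmul : A →L[ℂ] B →L[ℂ] ProjectiveTensorProduct A B :=
  LinearMap.mkContinuous₂ (LinearMap.mk₂ ℂ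
    (fun a b => ofAlgebraic (A := A) (B := B) (a ⊗ₜ[ℂ] b))
    (fun a a' b => (congrArg ofAlgebraic (TensorProduct.add_tmul a a' b)).trans
      (ofAlgebraic_add _ _))
    (fun c a b => ofAlgebraic_smul (A := A) (B := B) c (a ⊗ₜ[ℂ] b))
    (fun a b b' => (congrArg ofAlgebraic (TensorProduct.tmul_add a b b')).trans
      (ofAlgebraic_add _ _))
    (fun c a b => (congrArg ofAlgebraic (TensorProduct.tmul_smul c a b)).trans
      (ofAlgebraic_smul c _))) 1 fun a b => by
    rw [one_mul]
    exact (norm_ofAlgebraic (A := A) (B := B) (a ⊗ₜ[ℂ] b)).trans_le (projectiveTensorNorm.tmul_le a b)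

theorem tmul_apply (a : A) (b : B) :
    tmul a b = ofAlgebraic (A := A) (B := B) (a ⊗ₜ[ℂ] b) := rfl

section Lift

variable [NormedAddCommGroup C] [NormedSpace ℂ C] [CompleteSpace C]

/-- A bounded bilinear map as a bounded linear map on the algebraic tensor product. -/
noncomputable def algebraicLift (f : A →L[ℂ] B →L[ℂ] C) : AlgebraicProjectiveTensor A B →L[ℂ] C :=
  LinearMap.mkContinuous
    (TensorProduct.lift ((ContinuousLinearMap.coeLM ℂ).comp (f : A →ₗ[ℂ] B →L[ℂ] C)) :
      A ⊗[ℂ] B →ₗ[ℂ] C) ‖f‖ fun u => by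
    refine le_of_forall_pos_le_add fun ε hε => ?_
    -- The infimum defining the norm need not be attained, so a nearly optimal representation is
    -- used. The slack is chosen so that multiplying it by `‖f‖` costs at most `ε`; the `+ 1` covers
    -- `f = 0`.
    obtain ⟨n, a, b, hu, h⟩ := projectiveTensorNorm.exists_lt (A := A) (B := B) u
      (ε := ε / (‖f‖ + 1)) (by positivity)
    have h1 : ‖f‖ * (ε / (‖f‖ + 1)) ≤ ε := by
      rw [← mul_div_assoc, div_le_iff₀ (by positivity)]; nlinarith [norm_nonneg f]
    calc _ = ‖∑ i, f (a i) (b i)‖ := by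
          rw [hu]
          exact congrArg norm (map_sum (TensorProduct.lift ((ContinuousLinearMap.coeLM ℂ).comp
            (f : A →ₗ[ℂ] B →L[ℂ] C))) _ _)
      _ ≤ ∑ i, ‖f‖ * (‖a i‖ * ‖b i‖) := norm_sum_le_of_le _ fun i _ => by
          rw [← mul_assoc]
          exact f.le_opNorm₂ _ _
      _ ≤ ‖f‖ * (projectiveTensorNorm (A := A) (B := B) u + ε / (‖f‖ + 1)) := by
          rw [← Finset.mul_sum]
          gcongr
      _ ≤ ‖f‖ * projectiveTensorNorm (A := A) (B := B) u + ε := by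
          rw [mul_add]
          gcongr

/-- The bounded linear map on the projective tensor product given by a bounded bilinear map. -/
noncomputable def lift (f : A →L[ℂ] B →L[ℂ] C) : ProjectiveTensorProduct A B →L[ℂ] C :=
  (algebraicLift f).extend (UniformSpace.Completion.toComplL (𝕜 := ℂ)
    (E := AlgebraicProjectiveTensor A B))

theorem lift_ofAlgebraic (f : A →L[ℂ] B →L[ℂ] C) (u : AlgebraicProjectiveTensor A B) :
    lift f (ofAlgebraic u) = algebraicLift f u :=
  (algebraicLift f).extend_eq UniformSpace.Completion.denseRange_coe
    (UniformSpace.Completion.isUniformInducing_coe _) u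

theorem lift_tmul (f : A →L[ℂ] B →L[ℂ] C) (a : A) (b : B) : lift f (tmul a b) = f a b :=
  lift_ofAlgebraic f (a ⊗ₜ[ℂ] b)

end Lift

variable [IsScalarTower ℂ A A] [SMulCommClass ℂ A A] [IsScalarTower ℂ B B] [SMulCommClass ℂ B B]

theorem tmul_mul_tmul (a : A) (b : B) (a' : A) (b' : B) :
    tmul a b * tmul a' b' = tmul (a * a') (b * b') :=
  (ofAlgebraic_mul (A := A) (B := B) (a ⊗ₜ[ℂ] b) (a' ⊗ₜ[ℂ] b')).symm.trans
    (congrArg ofAlgebraic (Algebra.TensorProduct.tmul_mul_tmul a a' b b'))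

/-- Both sides are continuous and biadditive, so density of the algebraic tensors reduces the claim
to elementary tensors, where it is `hf`. -/
theorem lift_mul [NonUnitalNormedRing C] [NormedSpace ℂ C] [CompleteSpace C]
    (f : A →L[ℂ] B →L[ℂ] C)
    (hf : ∀ a b a' b', f (a * a') (b * b') = f a b * f a' b') (x y : ProjectiveTensorProduct A B) :
    lift f (x * y) = lift f x * lift f y := by
  refine induction_on x (isClosed_eq (by fun_prop) (by fun_prop)) fun u => ?_
  refine induction_on y (isClosed_eq (by fun_prop) (by fun_prop)) fun v => ?_
  refine TensorProduct.induction_on u ?_ (fun a b => ?_) fun u₁ u₂ h₁ h₂ => ?_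
  · have : ofAlgebraic (A := A) (B := B) (0 : A ⊗[ℂ] B) = 0 := UniformSpace.Completion.coe_zero
    rw [this, zero_mul, map_zero, zero_mul]
  · refine TensorProduct.induction_on v ?_ (fun a' b' => ?_) fun v₁ v₂ h₁ h₂ => ?_
    · have : ofAlgebraic (A := A) (B := B) (0 : A ⊗[ℂ] B) = 0 := UniformSpace.Completion.coe_zero
      rw [this, mul_zero, map_zero, mul_zero]
    · rw [← tmul_apply, ← tmul_apply, tmul_mul_tmul, lift_tmul, lift_tmul, lift_tmul, hf]
    · have : ofAlgebraic (A := A) (B := B) (v₁ + v₂ : A ⊗[ℂ] B) = _ := ofAlgebraic_add (A := A) (B := B) _ _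
      rw [this, mul_add, map_add, map_add, mul_add, h₁, h₂]
  · have : ofAlgebraic (A := A) (B := B) (u₁ + u₂ : A ⊗[ℂ] B) = _ := ofAlgebraic_add (A := A) (B := B) _ _
    rw [this, add_mul, map_add, map_add, add_mul, h₁, h₂]

end ProjectiveTensorProduct

/-! ### The augmentation character and approximate units of Beurling algebras. -/

namespace BeurlingAlgebra

open MeasureTheory BeurlingAux Filter Topology
open scoped ENNReal Pointwise

/-- Translates of a continuous function with compact support converge uniformly. -/
theorem exists_nhds_translate_sub_le {G : Type*} [Group G] [TopologicalSpace G]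
    {b : G → ℂ} (hb : IsCc b) {s : G → G → G}
    (hs : Continuous fun p : G × G => s p.1 p.2) (hs1 : ∀ x, s 1 x = x) {K : Set G}
    (hK : IsCompact K) {ε : ℝ} (hε : 0 < ε) :
    ∀ᶠ y in 𝓝 (1 : G), ∀ x ∈ K, ‖b (s y x) - b x‖ ≤ ε := by
  -- Tube lemma: by compactness of `K` it is enough to have the estimate near each point `(1, x)`.
  -- The family `s` is general so that left and right translations are treated together.
  refine hK.eventually_forall_of_forall_eventually fun x _ => ?_
  have hc : Continuous fun p : G × G => ‖b (s p.1 p.2) - b p.2‖ :=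
    ((hb.1.comp hs).sub (hb.1.comp continuous_snd)).norm
  have : Tendsto (fun p : G × G => ‖b (s p.1 p.2) - b p.2‖) (𝓝 (1, x)) (𝓝 0) := by
    simpa [hs1] using hc.tendsto (1, x)
  filter_upwards [this.eventually (gt_mem_nhds hε)] with p hp using hp.le

/-- As `e dμ` has total mass one, the difference is the `e`-average of `c - w`, and only points with
`e y ≠ 0` contribute. -/
theorem norm_integral_bump_sub_le {G : Type*} [TopologicalSpace G] [MeasurableSpace G]
    [BorelSpace G] {μ : Measure G} {e : G → ℝ} (he : Continuous e) (hes : HasCompactSupport e)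
    [IsFiniteMeasureOnCompacts μ] (he0 : ∀ x, 0 ≤ e x) (heI : ∫ x, e x ∂μ = 1) {c : G → ℂ}
    (hc : Continuous c) {w : ℂ} {δ : ℝ} (hδ : ∀ y, e y ≠ 0 → ‖c y - w‖ ≤ δ) :
    ‖∫ y, (e y : ℂ) * c y ∂μ - w‖ ≤ δ := by
  have hec : Continuous fun y => (e y : ℂ) := Complex.continuous_ofReal.comp he
  have hes' : HasCompactSupport fun y => (e y : ℂ) := hes.comp_left Complex.ofReal_zero
  have hw : ∫ y, (e y : ℂ) * w ∂μ = w := by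
    rw [integral_mul_const, integral_complex_ofReal, heI, Complex.ofReal_one, one_mul]
  have e1 : ∫ y, (e y : ℂ) * c y ∂μ - w = ∫ y, (e y : ℂ) * (c y - w) ∂μ := by
    conv_lhs => rw [← hw]
    simp only [mul_sub]
    exact (integral_sub ((hec.mul hc).integrable_of_hasCompactSupport hes'.mul_right)
      ((hec.mul continuous_const).integrable_of_hasCompactSupport hes'.mul_right)).symm
  rw [e1]
  calc ‖∫ y, (e y : ℂ) * (c y - w) ∂μ‖ ≤ ∫ y, e y * δ ∂μ := by
        refine norm_integral_le_of_norm_le ((he.mul continuous_const).integrable_of_hasCompactSupport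
          hes.mul_right) (Eventually.of_forall fun y => ?_)
        rw [norm_mul, Complex.norm_real, Real.norm_of_nonneg (he0 y)]
        by_cases hy : e y = 0
        · simp [hy]
        · exact mul_le_mul_of_nonneg_left (hδ y hy) (he0 y)
    _ = δ := by rw [integral_mul_const, heI, one_mul]

variable {G : Type*} [Group G] [TopologicalSpace G] [MeasurableSpace G] [BorelSpace G]
  {μ : Measure G} {ω : WeightFunction G}

theorem integrable_of_weighted {f : G → ℂ} (hf : Integrable f (weightedMeasure μ ω)) :
    Integrable f μ :=
  ⟨hf.1.mono_ac (ac_weighted μ ω), (lintegral_le_weighted μ ω _).trans_lt hf.2⟩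

/-- The augmentation character `f ↦ ∫ f dμ` of the Beurling algebra. -/
noncomputable def augmentation : BeurlingAlgebra μ ω →L[ℂ] ℂ :=
  LinearMap.mkContinuous
    { toFun := fun f => ∫ x, f.rep x ∂μ
      map_add' := fun f g => by
        rw [integral_congr_ae (rep_add f g)]
        exact integral_add (integrable_of_weighted f.integrable_rep)
          (integrable_of_weighted g.integrable_rep)
      map_smul' := fun c f => by
        rw [integral_congr_ae (rep_smul c f)]
        exact integral_smul c _ } 1 fun f => by
    rw [one_mul, norm_eq]
    refine (norm_integral_le_integral_norm _).trans (integral_mono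
      (integrable_of_weighted f.integrable_rep).norm ?_ fun x => ?_)
    · refine ((integrable_weighted_iff μ ω).1 f.integrable_rep).norm.congr
        (Eventually.of_forall fun x => ?_)
      simp only [norm_smul, Real.norm_of_nonneg (weight_pos ω x).le]
    -- The bound `ω ≥ 1` makes the weighted norm dominate the `L¹` norm, so the augmentation is
    -- bounded with constant one.
    · exact le_mul_of_one_le_left (norm_nonneg _) (ω.one_le x)

theorem augmentation_ofIntegrable {f : G → ℂ} (hf : Integrable f (weightedMeasure μ ω)) :
    augmentation (ofIntegrable f hf) = ∫ x, f x ∂μ :=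
  integral_congr_ae (rep_ofIntegrable hf)

/-- Turns uniform estimates into norm estimates once `h` is taken to be a fixed compactly supported
cutoff. -/
theorem norm_ofIntegrable_le_of_norm_le {F : G → ℂ} (hF : Integrable F (weightedMeasure μ ω))
    {h : G → ℂ} {hh : Integrable h (weightedMeasure μ ω)} {ε : ℝ} (hε : 0 ≤ ε)
    (hle : ∀ x, ‖F x‖ ≤ ε * ‖h x‖) :
    ‖ofIntegrable F hF‖ ≤ ε * ‖ofIntegrable (ω := ω) h hh‖ := by
  have : ‖ofIntegrable F hF‖ₑ ≤ ENNReal.ofReal ε * ‖ofIntegrable (ω := ω) h hh‖ₑ := by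
    rw [enorm_ofIntegrable, enorm_ofIntegrable, ← lintegral_const_mul' _ _ ENNReal.ofReal_ne_top]
    refine lintegral_mono fun x => ?_
    rw [← ofReal_norm, ← ofReal_norm, ← ENNReal.ofReal_mul hε]
    exact ENNReal.ofReal_le_ofReal (hle x)
  have := ENNReal.toReal_mono (ENNReal.mul_ne_top ENNReal.ofReal_ne_top enorm_ne_top) this
  simpa [ENNReal.toReal_mul, ENNReal.toReal_ofReal hε] using this

variable [IsTopologicalGroup G] [LocallyCompactSpace G]

/-- Fubini and left invariance. For continuous kernels with compact support the interchange of
integrals requires no σ-finiteness of Haar measure. -/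
theorem integral_groupConvolution [μ.IsHaarMeasure] {φ ψ : G → ℂ} (hφ : IsCc φ) (hψ : IsCc ψ) :
    ∫ x, groupConvolution μ φ ψ x ∂μ = (∫ x, φ x ∂μ) * ∫ x, ψ x ∂μ := by
  have := hφ.1
  have := hψ.1
  calc ∫ x, groupConvolution μ φ ψ x ∂μ = ∫ y, ∫ x, φ y * ψ (y⁻¹ * x) ∂μ ∂μ := by
        symm
        refine integral_integral_swap_of_hasCompactSupport ?_ ?_
        · simp only [Function.uncurry_def]
          fun_prop
        · exact kernel_compact hφ.2 hψ.2
    _ = ∫ y, φ y * ∫ x, ψ x ∂μ ∂μ := by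
        refine integral_congr_ae (Eventually.of_forall fun y => ?_)
        simp only [integral_const_mul]
        rw [integral_mul_left_eq_self ψ y⁻¹]
    _ = _ := integral_mul_const _ _

/-- By continuity it suffices to treat the dense set of classes of compactly supported continuous
functions. -/
theorem augmentation_mul [μ.IsHaarMeasure] [μ.Regular] (f g : BeurlingAlgebra μ ω) :
    augmentation (f * g) = augmentation f * augmentation g := by
  refine induction_on f (isClosed_eq (by fun_prop) (by fun_prop)) fun φ hφ => ?_
  refine induction_on g (isClosed_eq (by fun_prop) (by fun_prop)) fun ψ hψ => ?_
  rw [ofIntegrable_mul hφ hψ, augmentation_ofIntegrable, augmentation_ofIntegrable,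
    augmentation_ofIntegrable, integral_groupConvolution hφ hψ]

/-- In every neighbourhood of the identity lives a symmetric nonnegative continuous function with
compact support and integral one. -/
theorem exists_symmetric_bump [μ.IsHaarMeasure] {V : Set G} (hV : V ∈ 𝓝 (1 : G)) :
    ∃ e : G → ℝ, Continuous e ∧ HasCompactSupport e ∧ (∀ x, 0 ≤ e x) ∧ (∀ x, e x⁻¹ = e x) ∧
      (∀ x, x ∉ V → e x = 0) ∧ ∫ x, e x ∂μ = 1 := by
  obtain ⟨U, hUV, hU, h1U⟩ := mem_nhds_iff.1 hV
  obtain ⟨f, f1, f0, fc, fI⟩ := exists_continuous_one_zero_of_isCompact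
    (isCompact_singleton (x := (1 : G))) hU.isClosed_compl (by simpa using h1U)
  -- Multiplying by the reflected function gives symmetry without requiring `V` to be symmetric: the
  -- factor `f x` already forces `g` to vanish off `V`.
  set g : G → ℝ := fun x => f x * f x⁻¹ with hg
  have g_cont : Continuous g := f.continuous.mul (f.continuous.comp continuous_inv)
  have g_supp : HasCompactSupport g := fc.mul_right
  have g_nonneg : ∀ x, 0 ≤ g x := fun x => mul_nonneg (fI x).1 (fI _).1
  have g1 : g 1 ≠ 0 := by
    have : f 1 = 1 := f1 rfl
    simp [hg, this]
  have I_pos : 0 < ∫ x, g x ∂μ :=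
    g_cont.integral_pos_of_hasCompactSupport_nonneg_nonzero g_supp g_nonneg g1
  refine ⟨fun x => (∫ x, g x ∂μ)⁻¹ * g x, continuous_const.mul g_cont, g_supp.mul_left,
    fun x => mul_nonneg (inv_nonneg.2 I_pos.le) (g_nonneg x), fun x => ?_, fun x hx => ?_, ?_⟩
  · simp only [hg, inv_inv, mul_comm (f x⁻¹)]
  · have : f x = 0 := f0 fun h => hx (hUV h)
    simp [hg, this]
  · rw [integral_const_mul, inv_mul_cancel₀ I_pos.ne']

/-- Approximate units for continuous functions with compact support. -/
theorem exists_approximate_unit [μ.IsHaarMeasure] [μ.Regular] {b : G → ℂ} (hb : IsCc b) {ε : ℝ}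
    (hε : 0 < ε) : ∃ e : BeurlingAlgebra μ ω,
      ‖e * ofIntegrable b hb.weighted_integrable - ofIntegrable b hb.weighted_integrable‖ ≤ ε ∧
      ‖ofIntegrable b hb.weighted_integrable * e - ofIntegrable b hb.weighted_integrable‖ ≤ ε := by
  obtain ⟨W, hW, hW1⟩ := exists_compact_mem_nhds (1 : G)
  set S := tsupport b
  have hS : IsCompact S := hb.2
  -- For `y ∈ W`, this compact set contains the supports of `b` and of its translates `x ↦ b (y⁻¹ *
  -- x)` and `x ↦ b (x * y)`.
  set K := S ∪ (W * S ∪ S * W⁻¹)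
  have hK : IsCompact K := hS.union ((hW.mul hS).union (hS.mul hW.inv))
  obtain ⟨h, h1, -, hc, -⟩ := exists_continuous_one_zero_of_isCompact hK isClosed_empty
    (Set.disjoint_empty K)
  have hh : IsCc fun x => (h x : ℂ) :=
    ⟨Complex.continuous_ofReal.comp h.continuous, hc.comp_left Complex.ofReal_zero⟩
  -- `N` is the weighted norm of a cutoff equal to one on `K`. A uniform error of `ε / (N + 1)`
  -- supported in `K` thus has weighted norm at most `ε`.
  set N := ‖ofIntegrable (ω := ω) _ (hh.weighted_integrable (μ := μ))‖
  have hδ : 0 < ε / (N + 1) := by positivity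
  have hδN : ε / (N + 1) * N ≤ ε := by
    rw [div_mul_eq_mul_div, div_le_iff₀ (by positivity)]
    nlinarith
  have t₁ := exists_nhds_translate_sub_le hb (s := fun y x => y⁻¹ * x) (by fun_prop) (by simp)
    hK hδ
  have t₂ := exists_nhds_translate_sub_le hb (s := fun y x => x * y) (by fun_prop) (by simp)
    hK hδ
  obtain ⟨e, ec, es, e0, einv, eV, eI⟩ := exists_symmetric_bump (μ := μ)
    (inter_mem hW1 (inter_mem t₁ t₂))
  have he : IsCc fun x => (e x : ℂ) :=
    ⟨Complex.continuous_ofReal.comp ec, es.comp_left Complex.ofReal_zero⟩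
  -- Both products with the bump are averages of translates of `b`, so a single estimate,
  -- parametrised by the translation `s`, serves for the two sides.
  have bound : ∀ (F : G → ℂ) (hF : IsCc F) (s : G → G → G), (∀ x, Continuous fun y => s y x) →
      (∀ x, F x = ∫ y, (e y : ℂ) * b (s y x) ∂μ) →
      (∀ y, e y ≠ 0 → ∀ x ∈ K, ‖b (s y x) - b x‖ ≤ ε / (N + 1)) →
      (∀ y ∈ W, ∀ x, s y x ∈ S → x ∈ K) →
      ‖ofIntegrable (ω := ω) F (hF.weighted_integrable (μ := μ)) -
        ofIntegrable b hb.weighted_integrable‖ ≤ ε := by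
    intro F hF s hs hFs hsb hsK
    have e1 : ofIntegrable (ω := ω) F (hF.weighted_integrable (μ := μ)) -
        ofIntegrable b hb.weighted_integrable =
        ofIntegrable (F - b) (hF.sub hb).weighted_integrable :=
      (Integrable.toL1_sub F b hF.weighted_integrable hb.weighted_integrable).symm
    rw [e1]
    refine (norm_ofIntegrable_le_of_norm_le (hh := hh.weighted_integrable) _ hδ.le
      fun x => ?_).trans hδN
    rw [Pi.sub_apply, hFs]
    refine norm_integral_bump_sub_le ec es e0 eI (hb.1.comp (hs x)) fun y hy => ?_
    by_cases hx : x ∈ K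
    · have : h x = 1 := h1 hx
      simpa [this] using hsb y hy x hx
    -- Off `K`, both `b x` and its translate vanish, so the error is zero there.
    · have hyW : y ∈ W := by
        by_contra hyW
        exact hy (eV y fun h => hyW h.1)
      have hb1 : b (s y x) = 0 := image_eq_zero_of_notMem_tsupport fun hm => hx (hsK y hyW x hm)
      have hb2 : b x = 0 := image_eq_zero_of_notMem_tsupport fun hm => hx (Or.inl hm)
      rw [Function.comp_apply, hb1, hb2, sub_zero, norm_zero]
      positivity
  have hV : ∀ y, e y ≠ 0 → y ∈ W ∩ ({y | ∀ x ∈ K, ‖b (y⁻¹ * x) - b x‖ ≤ ε / (N + 1)} ∩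
      {y | ∀ x ∈ K, ‖b (x * y) - b x‖ ≤ ε / (N + 1)}) := fun y hy => by
    by_contra hyV
    exact hy (eV y hyV)
  refine ⟨ofIntegrable _ he.weighted_integrable, ?_, ?_⟩
  · rw [ofIntegrable_mul he hb]
    refine bound _ (he.convolution hb) (fun y x => y⁻¹ * x) (fun x => by fun_prop) (fun x => rfl)
      (fun y hy => (hV y hy).2.1) fun y hy x hx => Or.inr (Or.inl ?_)
    exact ⟨y, hy, _, hx, by simp⟩
  · rw [ofIntegrable_mul hb he]
    refine bound _ (hb.convolution he) (fun y x => x * y) (fun x => by fun_prop) (fun x => ?_)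
      (fun y hy => (hV y hy).2.2) fun y hy x hx => Or.inr (Or.inr ?_)
    · simp only [groupConvolution]
      -- Substituting `x * y` for `y` turns `∫ b(y) e(y⁻¹x) dy` into `∫ b(xy) e(y⁻¹) dy`. The
      -- symmetry of `e` replaces `e(y⁻¹)` by `e(y)`, so no modular function appears and the same
      -- `e` works on both sides.
      rw [← integral_mul_left_eq_self _ x]
      refine integral_congr_ae (Eventually.of_forall fun y => ?_)
      simp only [mul_inv_rev, inv_mul_cancel_right, einv, mul_comm (b _)]
    · exact ⟨_, hx, y⁻¹, Set.inv_mem_inv.2 hy, by simp⟩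

/-- The Beurling algebra contains an element of augmentation one with approximate units. -/
theorem exists_augmentation_eq_one [μ.IsHaarMeasure] [μ.Regular] :
    ∃ b : BeurlingAlgebra μ ω, augmentation b = 1 ∧
      ∀ ε : ℝ, 0 < ε → ∃ e : BeurlingAlgebra μ ω, ‖e * b - b‖ ≤ ε ∧ ‖b * e - b‖ ≤ ε := by
  -- Only compact support and integral one matter for this element, so no localisation near the
  -- identity is imposed.
  obtain ⟨f, fc, fs, -, -, -, fI⟩ := exists_symmetric_bump (μ := μ) univ_mem
  have hf : IsCc fun x => (f x : ℂ) :=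
    ⟨Complex.continuous_ofReal.comp fc, fs.comp_left Complex.ofReal_zero⟩
  refine ⟨ofIntegrable _ hf.weighted_integrable, ?_, fun ε hε => exists_approximate_unit hf hε⟩
  rw [augmentation_ofIntegrable, integral_complex_ofReal, fI, Complex.ofReal_one]

end BeurlingAlgebra

/-! ### Application of the criterion to each factor. -/

open ProjectiveTensorProduct BeurlingAlgebra

theorem corollary4p8 {G₁ G₂ : Type*}
    [Group G₁] [TopologicalSpace G₁] [IsTopologicalGroup G₁] [LocallyCompactSpace G₁] [Infinite G₁]
    [MeasurableSpace G₁] [BorelSpace G₁]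
    [Group G₂] [TopologicalSpace G₂] [IsTopologicalGroup G₂] [LocallyCompactSpace G₂] [Infinite G₂]
    [MeasurableSpace G₂] [BorelSpace G₂]
    (μ₁ : MeasureTheory.Measure G₁) [μ₁.IsHaarMeasure] [μ₁.Regular]
    (μ₂ : MeasureTheory.Measure G₂) [μ₂.IsHaarMeasure] [μ₂.Regular]
    (ω₁ : WeightFunction G₁) (ω₂ : WeightFunction G₂)
    (h : IsWeaklyAmenable
      (ProjectiveTensorProduct (BeurlingAlgebra μ₁ ω₁) (BeurlingAlgebra μ₂ ω₂))) :
    IsWeaklyAmenable (BeurlingAlgebra μ₁ ω₁) ∧ IsWeaklyAmenable (BeurlingAlgebra μ₂ ω₂) := by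
  constructor
  · obtain ⟨b, hb, he⟩ := exists_augmentation_eq_one (μ := μ₂) (ω := ω₂)
    refine h.of_character tmul tmul_mul_tmul augmentation augmentation_mul
      -- The homomorphism `id ⊗ φ`, determined by `a ⊗ b ↦ φ(b) a`.
      (lift ((ContinuousLinearMap.lsmul ℂ ℂ).flip.bilinearComp (.id ℂ _) augmentation))
      (lift_mul _ fun a b a' b' => ?_) (lift_tmul _) b hb he
    change augmentation (b * b') • (a * a') = (augmentation b • a) * (augmentation b' • a')
    rw [augmentation_mul, smul_mul_smul_comm]
  · obtain ⟨b, hb, he⟩ := exists_augmentation_eq_one (μ := μ₁) (ω := ω₁)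
    -- The criterion asks only for a multiplicative bilinear map into `P`, so flipping `tmul`
    -- exchanges the factors without identifying the two orders of the tensor product. The
    -- homomorphism is now `φ ⊗ id`.
    refine h.of_character tmul.flip (fun a b a' b' => tmul_mul_tmul b a b' a') augmentation
      augmentation_mul (lift ((ContinuousLinearMap.lsmul ℂ ℂ).bilinearComp augmentation (.id ℂ _)))
      (lift_mul _ fun a b a' b' => ?_) (fun a b => lift_tmul _ b a) b hb he
    change augmentation (a * a') • (b * b') = (augmentation a • b) * (augmentation a' • b')
    rw [augmentation_mul, smul_mul_smul_comm]
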